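/- Let $K$ be a field of arbitrary characteristic with algebraic closure $\overline K$, and let $\phi=[F_1:G_1]\colon\mathbb P^1\to\mathbb P^1$ be a rational map of degree $d\ge 2$ over $K$, where $F_1,G_1\in K[x,y]$ are homogeneous of degree $d$ without a common factor over $\overline K$. Let $h\in \mathrm{PGL}_2(K)$ be an automorphism of $\phi$ (that is, $h^{-1}\phi h=\phi$) of prime order $p$, and assume that all fixed points of $h$ in $\mathbb P^1(\overline K)$ are defined over $K$. Represent $h$ by an invertible matrix over $K$ and $h^j$ by its $j$-th power. Write $\phi^N=[F_N:G_N]$ with $F_N=F_{N-1}(F_1,G_1)$, $G_N=G_{N-1}(F_1,G_1)$. Put $$\Phi_N=yF_N-xG_N,\qquad \Phi_N^*=\prod_{k\mid N}\Phi_k^{\mu(N/k)} .$$ For $h^j=[ax+by:cx+dy]$ let $\phi^N-h^j$ denote the polynomial $(cx+dy)F_N-(ax+by)G_N$, and put $$\Psi_{pN}=\prod_{j=1}^{p-1}(\phi^N-h^j),\qquad \Psi_{pN}^*=\prod_{k\mid N,\ pk\nmid N}\Psi_{pk}^{\mu(N/k)},\qquad \widetilde{\Psi}_{pN}^*=\frac{\Psi_{pN}^*}{\prod_{P=[x_P:y_P]\in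 \mathrm{Fix}(h)}(y_Px-x_Py)^{\delta_P}},$$ where $\mu$ is the Möbius function and $\delta_P$ is the order of $\Psi^*_{pN}$ along $y_Px-x_Py$; $\widetilde{\Psi}_{pN}^*$ is the $h$-tuned dynatomic polynomial, and $\Phi_{N}^*$ the $N$-th dynatomic polynomial. For $Q\in\mathbb P^1(\overline K)$ let $a_Q^*(N)$ and $\widetilde b_Q^*(pN)$ be the orders of vanishing at $Q$ of $\Phi_N^*$ and of $\widetilde{\Psi}_{pN}^*$. Then for every $N\ge 1$ both $\Phi_{pN}^*$ and $\widetilde{\Psi}_{pN}^*$, defined a priori as rational functions, lie in $K[x,y]$, and $\widetilde{\Psi}_{pN}^*$ divides $\Phi_{pN}^*$ in $K[x,y]$. Moreover (equivalently) $a_Q^*(pN)\ge \widetilde b_Q^*(pN)$ for every point $Q\in\mathbb P^1(\overline K)$. -/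

import Mathlib

open scoped LinearAlgebra.Projectivization MatrixGroups

noncomputable section

namespace Dynatomic

/-- A pair `[F₀ : F₁]` of polynomials in the homogeneous coordinates `x = X 0`, `y = X 1`. -/
abbrev Pair (K : Type*) [Field K] := Fin 2 → MvPolynomial (Fin 2) K

/-- The field of rational functions in `x, y`. -/
abbrev RatFun (K : Type*) [Field K] := FractionRing (MvPolynomial (Fin 2) K)

namespace Pair

/-- Base change along a field homomorphism. -/
def map {K L : Type*} [Field K] [Field L] (σ : K →+* L) (φ : Pair K) : Pair L :=
  fun i => MvPolynomial.map σ (φ i)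

/-- The pair `φ` defines a rational map `ℙ¹ → ℙ¹` of degree `d`: both entries are homogeneous of
degree `d` and they have no common factor over an algebraic closure. -/
structure IsRationalMap {K : Type*} [Field K] (φ : Pair K) (d : ℕ) : Prop where
  homogeneous : ∀ i, (φ i).IsHomogeneous d
  coprime : IsRelPrime (φ.map (algebraMap K (AlgebraicClosure K)) 0)
    (φ.map (algebraMap K (AlgebraicClosure K)) 1)

/-- The composition `φ ∘ ψ`: substitute the entries of `ψ` for `x, y` in those of `φ`. -/
def comp {K : Type*} [Field K] (φ ψ : Pair K) : Pair K :=
  fun i => MvPolynomial.bind₁ ψ (φ i)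

/-- The iterate `φ^N = [F_N : G_N]`, with `F_0 = x`, `G_0 = y` and
`F_{N+1} = F_N(F_1, G_1)`, `G_{N+1} = G_N(F_1, G_1)`. -/
def iter {K : Type*} [Field K] (φ : Pair K) : ℕ → Pair K
  | 0 => MvPolynomial.X
  | N + 1 => (iter φ N).comp φ

/-- The linear map `[ax + by : cx + dy]` of a matrix with rows `(a, b)` and `(c, d)`. -/
def ofMatrix {K : Type*} [Field K] (h : GL (Fin 2) K) : Pair K :=
  fun i => ∑ j, MvPolynomial.C (h.1 i j) * MvPolynomial.X j

/-- `h` is an automorphism of `φ`: the pairs `h⁻¹ ∘ φ ∘ h` and `φ` define the same rational map,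
that is, they agree up to a nonzero constant. -/
def HasAut {K : Type*} [Field K] (φ : Pair K) (h : GL (Fin 2) K) : Prop :=
  ∃ u : K, u ≠ 0 ∧
    (ofMatrix h⁻¹).comp (φ.comp (ofMatrix h)) = fun i => MvPolynomial.C u * φ i

/-- The polynomial `ψ₁ φ₀ - ψ₀ φ₁`, whose zeros are the points where the maps `φ` and `ψ` agree. -/
def diff {K : Type*} [Field K] (φ ψ : Pair K) : MvPolynomial (Fin 2) K :=
  ψ 1 * φ 0 - ψ 0 * φ 1

end Pair

open Pair

/-- `Φ_N = y F_N - x G_N`. -/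
def periodPoly {K : Type*} [Field K] (φ : Pair K) (N : ℕ) : MvPolynomial (Fin 2) K :=
  MvPolynomial.X 1 * φ.iter N 0 - MvPolynomial.X 0 * φ.iter N 1

/-- The dynatomic polynomial `Φ*_N = ∏_{k ∣ N} Φ_k ^ μ(N / k)`, as a rational function. -/
def dynatomic {K : Type*} [Field K] (φ : Pair K) (N : ℕ) : RatFun K :=
  ∏ k ∈ N.divisors, algebraMap (MvPolynomial (Fin 2) K) (RatFun K) (periodPoly φ k) ^
    (ArithmeticFunction.moebius (N / k))

/-- `Ψ_{pN} = ∏_{j=1}^{p-1} (φ^N - h^j)`. -/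
def psi {K : Type*} [Field K] (φ : Pair K) (h : GL (Fin 2) K) (p N : ℕ) :
    MvPolynomial (Fin 2) K :=
  ∏ j ∈ Finset.Icc 1 (p - 1), (φ.iter N).diff (ofMatrix (h ^ j))

/-- `Ψ*_{pN} = ∏_{k ∣ N, pk ∤ N} Ψ_{pk} ^ μ(N / k)`, as a rational function. -/
def psiStar {K : Type*} [Field K] (φ : Pair K) (h : GL (Fin 2) K) (p N : ℕ) : RatFun K :=
  ∏ k ∈ N.divisors.filter (fun k => ¬ p * k ∣ N),
    algebraMap (MvPolynomial (Fin 2) K) (RatFun K) (psi φ h p k) ^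
      (ArithmeticFunction.moebius (N / k))

/-- The linear form `y₀ x - x₀ y` of a point `Q = [x₀ : y₀]`. -/
def linearForm {K : Type*} [Field K] (Q : ℙ K (Fin 2 → K)) : MvPolynomial (Fin 2) K :=
  MvPolynomial.C (Q.rep 1) * MvPolynomial.X 0 - MvPolynomial.C (Q.rep 0) * MvPolynomial.X 1

/-- The order of a nonzero rational function along the linear form of `Q`; for a quotient of
homogeneous polynomials it is the order of vanishing at `Q`. -/
def ordAt {K : Type*} [Field K] (Q : ℙ K (Fin 2 → K)) (f : RatFun K) : ℤ :=
  (multiplicity (linearForm Q) (IsFractionRing.num (MvPolynomial (Fin 2) K) f) : ℤ) -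
    (multiplicity (linearForm Q)
      (IsFractionRing.den (MvPolynomial (Fin 2) K) f : MvPolynomial (Fin 2) K) : ℤ)

/-- The set of fixed points of `h` in `ℙ¹(K)`. -/
def fixedPoints {K : Type*} [Field K] (h : GL (Fin 2) K) : Set (ℙ K (Fin 2 → K)) :=
  {Q | (Matrix.ProjGenLinGroup.mk h : PGL(2, K)) • Q = Q}

/-- The `h`-tuned dynatomic polynomial: `Ψ*_{pN}` divided by
`∏_{P ∈ Fix(h)} (y_P x - x_P y) ^ ord_P(Ψ*_{pN})`, as a rational function. -/
def tuned {K : Type*} [Field K] (φ : Pair K) (h : GL (Fin 2) K) (p N : ℕ) : RatFun K :=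
  psiStar φ h p N / ∏ᶠ P ∈ fixedPoints h,
    algebraMap (MvPolynomial (Fin 2) K) (RatFun K) (linearForm P) ^ ordAt P (psiStar φ h p N)

/-- `Q ∈ ℙ¹(K̄)` is defined over `K`: it has homogeneous coordinates in `K`. -/
def IsDefinedOver (K : Type*) [Field K]
    (Q : ℙ (AlgebraicClosure K) (Fin 2 → AlgebraicClosure K)) : Prop :=
  ∃ (v : Fin 2 → K) (hv : (fun i => algebraMap K (AlgebraicClosure K) (v i)) ≠ 0),
    Q = Projectivization.mk (AlgebraicClosure K)
      (fun i => algebraMap K (AlgebraicClosure K) (v i)) hv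

/-- The fixed points of `h` in `ℙ¹(K̄)`. -/
def geomFixedPoints {K : Type*} [Field K] (h : GL (Fin 2) K) :
    Set (ℙ (AlgebraicClosure K) (Fin 2 → AlgebraicClosure K)) :=
  fixedPoints (Matrix.GeneralLinearGroup.map (algebraMap K (AlgebraicClosure K)) h)

/-- `a*_Q(N)`, the order of vanishing of `Φ*_N` at a point `Q ∈ ℙ¹(K̄)`. -/
def aStar {K : Type*} [Field K] (φ : Pair K) (N : ℕ)
    (Q : ℙ (AlgebraicClosure K) (Fin 2 → AlgebraicClosure K)) : ℤ :=
  ordAt Q (dynatomic (φ.map (algebraMap K (AlgebraicClosure K))) N)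

/-- `b̃*_Q(pN)`, the order of vanishing of the `h`-tuned dynatomic polynomial at `Q ∈ ℙ¹(K̄)`. -/
def bTildeStar {K : Type*} [Field K] (φ : Pair K) (h : GL (Fin 2) K) (p N : ℕ)
    (Q : ℙ (AlgebraicClosure K) (Fin 2 → AlgebraicClosure K)) : ℤ :=
  ordAt Q (tuned (φ.map (algebraMap K (AlgebraicClosure K)))
    (Matrix.GeneralLinearGroup.map (algebraMap K (AlgebraicClosure K)) h) p N)

end Dynatomic

end

namespace Dynatomic

open MvPolynomial

section LinearForms

variable {K : Type*} [Field K]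

/-- The linear form `v₁ x - v₀ y` vanishing at the vector `v`. -/
noncomputable def vecForm (v : Fin 2 → K) : MvPolynomial (Fin 2) K :=
  C (v 1) * X 0 - C (v 0) * X 1

lemma linearForm_eq_vecForm (Q : ℙ K (Fin 2 → K)) : linearForm Q = vecForm Q.rep := rfl

lemma eval_vecForm (v w : Fin 2 → K) : eval w (vecForm v) = v 1 * w 0 - v 0 * w 1 := by
  simp [vecForm]

lemma vecForm_isHomogeneous (v : Fin 2 → K) : (vecForm v).IsHomogeneous 1 :=
  (isHomogeneous_C_mul_X _ _).sub (isHomogeneous_C_mul_X _ _)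

lemma vecForm_smul (c : K) (v : Fin 2 → K) : vecForm (c • v) = C c * vecForm v := by
  simp [vecForm]; ring

lemma exists_apply_ne_zero {v : Fin 2 → K} (hv : v ≠ 0) : ∃ i, v i ≠ 0 := Function.ne_iff.1 hv

lemma exists_eval_vecForm_ne_zero {v : Fin 2 → K} (hv : v ≠ 0) :
    ∃ w, eval w (vecForm v) ≠ 0 := by
  by_cases h : v 1 = 0
  · have h0 : v 0 ≠ 0 := by
      intro h0; apply hv; ext i; fin_cases i <;> simpa
    exact ⟨![0, 1], by simp [eval_vecForm, h0]⟩
  · exact ⟨![1, 0], by simp [eval_vecForm, h]⟩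

lemma vecForm_ne_zero {v : Fin 2 → K} (hv : v ≠ 0) : vecForm v ≠ 0 := by
  obtain ⟨w, hw⟩ := exists_eval_vecForm_ne_zero hv
  rintro h; simp [h] at hw

lemma vecForm_irreducible {v : Fin 2 → K} (hv : v ≠ 0) : Irreducible (vecForm v) := by
  refine irreducible_of_totalDegree_eq_one
    ((vecForm_isHomogeneous v).totalDegree (vecForm_ne_zero hv)) fun x hx => ?_
  rw [isUnit_iff_ne_zero]
  rintro rfl
  refine vecForm_ne_zero hv (MvPolynomial.ext _ _ fun i => ?_)
  simpa using hx i

lemma vecForm_prime {v : Fin 2 → K} (hv : v ≠ 0) : Prime (vecForm v) :=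
  (vecForm_irreducible hv).prime

lemma linearForm_prime (Q : ℙ K (Fin 2 → K)) : Prime (linearForm Q) := vecForm_prime Q.rep_nonzero

lemma eval_eq_zero_of_vecForm_dvd {v : Fin 2 → K} {F : MvPolynomial (Fin 2) K}
    (h : vecForm v ∣ F) : eval v F = 0 := by
  obtain ⟨G, rfl⟩ := h
  rw [map_mul, eval_vecForm]; ring

lemma aeval_mul_left {R : Type*} [CommRing R] [Algebra K R] {n : ℕ} {P : MvPolynomial (Fin 2) K}
    (hP : P.IsHomogeneous n) (c : R) (g : Fin 2 → R) :
    aeval (fun i => c * g i) P = c ^ n * aeval g P := by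
  rw [aeval_def, aeval_def, eval₂_eq, eval₂_eq, Finset.mul_sum]
  refine Finset.sum_congr rfl fun u hu => ?_
  have hdeg : ∑ i ∈ u.support, u i = n := by
    have := hP.degree_eq_sum_deg_support hu
    simpa using this.symm
  simp_rw [mul_pow]
  rw [Finset.prod_mul_distrib, Finset.prod_pow_eq_pow_sum, hdeg]
  ring

lemma dvd_aeval_sub_aeval {R : Type*} [CommRing R] [Algebra K R] {m : R} {f g : Fin 2 → R}
    (h : ∀ i, m ∣ f i - g i) (P : MvPolynomial (Fin 2) K) : m ∣ aeval f P - aeval g P := by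
  have key : ∀ i, Ideal.Quotient.mkₐ K (Ideal.span {m}) (f i) =
      Ideal.Quotient.mkₐ K (Ideal.span {m}) (g i) := fun i =>
    Ideal.Quotient.eq.2 (Ideal.mem_span_singleton.2 (h i))
  rw [← Ideal.mem_span_singleton, ← Ideal.Quotient.eq]
  change Ideal.Quotient.mkₐ K (Ideal.span {m}) _ = Ideal.Quotient.mkₐ K (Ideal.span {m}) _
  simp_rw [comp_aeval_apply, key]

lemma dvd_pow_mul_aeval_sub {R : Type*} [CommRing R] [Algebra K R] {m : R} {F G : Fin 2 → R}
    (h : m ∣ F 0 * G 1 - F 1 * G 0) {n : ℕ} {P : MvPolynomial (Fin 2) K} (hP : P.IsHomogeneous n)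
    (i : Fin 2) : m ∣ G i ^ n * aeval F P - F i ^ n * aeval G P := by
  rw [← aeval_mul_left hP, ← aeval_mul_left hP]
  refine dvd_aeval_sub_aeval (fun j => ?_) P
  fin_cases i <;> fin_cases j <;> simp only [Fin.zero_eta, Fin.mk_one]
  · rw [mul_comm, sub_self]; exact dvd_zero m
  · rw [← dvd_neg]; convert h using 1; ring
  · convert h using 1; ring
  · rw [mul_comm, sub_self]; exact dvd_zero m

lemma vecForm_dvd_of_eval_eq_zero {v : Fin 2 → K} (hv : v ≠ 0) {n : ℕ}
    {P : MvPolynomial (Fin 2) K} (hP : P.IsHomogeneous n) (h : eval v P = 0) : vecForm v ∣ P := by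
  obtain ⟨i, hi⟩ := exists_apply_ne_zero hv
  have h1 : vecForm v ∣ (X 0 : MvPolynomial (Fin 2) K) * C (v 1) - X 1 * C (v 0) :=
    dvd_of_eq (by rw [vecForm]; ring)
  have h2 := dvd_pow_mul_aeval_sub (F := X) (G := fun i => C (v i)) h1 hP i
  have h3 : aeval (fun i => (C (v i) : MvPolynomial (Fin 2) K)) P = C (eval v P) := by
    have := comp_aeval_apply (R := K) v (Algebra.ofId K (MvPolynomial (Fin 2) K)) P
    simpa [Algebra.ofId_apply, algebraMap_eq, aeval_eq_eval] using this.symm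
  rw [h3, h, map_zero, mul_zero, sub_zero, aeval_X_left_apply, ← map_pow] at h2
  have hu : IsUnit (C (v i ^ n) : MvPolynomial (Fin 2) K) :=
    (isUnit_iff_ne_zero.2 (pow_ne_zero n hi)).map C
  exact (hu.dvd_mul_left).1 h2

lemma vecForm_dvd_iff {v : Fin 2 → K} (hv : v ≠ 0) {n : ℕ}
    {P : MvPolynomial (Fin 2) K} (hP : P.IsHomogeneous n) : vecForm v ∣ P ↔ eval v P = 0 :=
  ⟨eval_eq_zero_of_vecForm_dvd, vecForm_dvd_of_eval_eq_zero hv hP⟩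

attribute [local instance] MvPolynomial.gradedAlgebra in
lemma isHomogeneous_of_mul {m n : ℕ} {F G : MvPolynomial (Fin 2) K} (hF : F.IsHomogeneous m)
    (hF0 : F ≠ 0) (h : (F * G).IsHomogeneous (m + n)) : G.IsHomogeneous n := by
  have h1 := DirectSum.coe_decompose_mul_add_of_left_mem (homogeneousSubmodule (Fin 2) K)
    (j := n) (b := G) ((mem_homogeneousSubmodule m F).2 hF)
  rw [DirectSum.decompose_of_mem_same _ ((mem_homogeneousSubmodule _ _).2 h)] at h1
  rw [← mem_homogeneousSubmodule, mul_left_cancel₀ hF0 h1]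
  exact SetLike.coe_mem _

lemma exists_eval_eq_zero [IsAlgClosed K] {n : ℕ} (hn : n ≠ 0) {P : MvPolynomial (Fin 2) K}
    (hP : P.IsHomogeneous n) : ∃ v ≠ 0, eval v P = 0 := by
  by_contra! H
  set q : Polynomial K := aeval ![Polynomial.X, 1] P with hq
  have hqe : ∀ t, q.eval t = eval ![t, 1] P := fun t => by
    have := comp_aeval_apply (R := K) ![Polynomial.X, 1] (Polynomial.aeval (R := K) t) P
    rw [← Polynomial.coe_aeval_eq_eval, hq]
    refine this.trans ?_
    rw [aeval_eq_eval]
    congr 2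
    ext i; fin_cases i <;> simp
  have hdeg : q.degree ≤ 0 := by
    by_contra hd
    obtain ⟨t, ht⟩ := IsAlgClosed.exists_root q (fun h => hd h.le)
    refine H ![t, 1] (fun h => ?_) ((hqe t).symm.trans ht)
    simpa using congrFun h 1
  have hc : ∀ t, eval ![t, 1] P = q.coeff 0 := fun t => by
    rw [← hqe, Polynomial.eq_C_of_degree_le_zero hdeg]; simp
  have hP' : X 1 * P = X 1 * (C (q.coeff 0) * X 1 ^ n) := by
    refine MvPolynomial.funext fun w => ?_
    by_cases h1 : w 1 = 0
    · simp [h1]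
    · have h2 := aeval_mul_left hP (w 1) ![w 0 / w 1, 1]
      have h3 : (fun i => w 1 * ![w 0 / w 1, 1] i) = w := by
        ext i; fin_cases i <;> simp [h1, mul_div_cancel₀]
      rw [h3, aeval_eq_eval, aeval_eq_eval, hc] at h2
      simp only [map_mul, eval_X, eval_C, map_pow, h2]
      ring
  have hP2 := mul_left_cancel₀ (X_ne_zero 1) hP'
  refine H ![1, 0] (fun h => by simpa using congrFun h 0) ?_
  rw [hP2]; simp [hn]

lemma multiplicity_mul_of_ne_zero {R : Type*} [CommRing R] [IsDomain R] [WfDvdMonoid R]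
    {l a b : R} (hl : Prime l) (ha : a ≠ 0) (hb : b ≠ 0) :
    multiplicity l (a * b) = multiplicity l a + multiplicity l b :=
  multiplicity_mul hl (FiniteMultiplicity.of_not_isUnit hl.not_isUnit (mul_ne_zero ha hb))

lemma dvd_of_multiplicity_le [IsAlgClosed K] {n : ℕ} {B : MvPolynomial (Fin 2) K}
    (hB : B.IsHomogeneous n) (hB0 : B ≠ 0) {A : MvPolynomial (Fin 2) K} (hA : A ≠ 0)
    (h : ∀ v : Fin 2 → K, v ≠ 0 → multiplicity (vecForm v) B ≤ multiplicity (vecForm v) A) :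
    B ∣ A := by
  induction n generalizing A B with
  | zero =>
    rw [← totalDegree_zero_iff_isHomogeneous] at hB
    rw [totalDegree_eq_zero_iff_eq_C.1 hB] at hB0 ⊢
    have : B.coeff 0 ≠ 0 := by rintro h; simp [h] at hB0
    exact ((isUnit_iff_ne_zero.2 this).map C).dvd
  | succ n ih =>
    obtain ⟨v, hv, hBv⟩ := exists_eval_eq_zero n.succ_ne_zero hB
    have hdB := vecForm_dvd_of_eval_eq_zero hv hB hBv
    have hdA : vecForm v ∣ A := dvd_of_multiplicity_pos
      ((multiplicity_pos_of_dvd hdB).trans_le (h v hv))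
    obtain ⟨B', rfl⟩ := hdB
    obtain ⟨A', rfl⟩ := hdA
    have hB' := right_ne_zero_of_mul hB0
    have hA' := right_ne_zero_of_mul hA
    refine mul_dvd_mul_left _ (ih (isHomogeneous_of_mul (vecForm_isHomogeneous v)
      (vecForm_ne_zero hv) (by rwa [add_comm])) hB' hA' fun w hw => ?_)
    have := h w hw
    rw [multiplicity_mul_of_ne_zero (vecForm_prime hw) (vecForm_ne_zero hv) hB',
      multiplicity_mul_of_ne_zero (vecForm_prime hw) (vecForm_ne_zero hv) hA'] at this
    omega

end LinearForms

section Descent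

lemma dvd_of_map_dvd_map {K L : Type*} [Field K] [Field L] (σ : K →+* L) {τ : Type*}
    {a b : MvPolynomial τ K} (h : map σ a ∣ map σ b) : a ∣ b := by
  classical
  let _ := σ.toAlgebra
  obtain ⟨c, hc⟩ := h
  obtain ⟨r, hr⟩ := (Algebra.linearMap K L).exists_leftInverse_of_injective
    (LinearMap.ker_eq_bot.2 σ.injective)
  have hr' : ∀ x, r (σ x) = x := fun x => LinearMap.congr_fun hr x
  have hrm : ∀ x y, r (σ x * y) = x * r y := fun x y => by
    have := r.map_smul x y
    rwa [Algebra.smul_def, smul_eq_mul] at this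
  have hcoeff : ∀ u, coeff u (∑ s ∈ c.support, monomial s (r (coeff s c))) = r (coeff u c) := by
    intro u
    simp only [coeff_sum, coeff_monomial, Finset.sum_ite_eq', mem_support_iff]
    split_ifs with h
    · rfl
    · rw [not_not.1 h, map_zero]
  refine ⟨∑ s ∈ c.support, monomial s (r (coeff s c)), MvPolynomial.ext _ _ fun u => ?_⟩
  rw [← hr' (coeff u b), ← coeff_map, hc, coeff_mul, coeff_mul, map_sum]
  refine Finset.sum_congr rfl fun x _ => ?_
  rw [coeff_map, hrm, hcoeff]

lemma map_dvd_map_iff {K L : Type*} [Field K] [Field L] (σ : K →+* L) {τ : Type*}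
    {a b : MvPolynomial τ K} : map σ a ∣ map σ b ↔ a ∣ b :=
  ⟨dvd_of_map_dvd_map σ, map_dvd (map σ)⟩

lemma multiplicity_map {K L : Type*} [Field K] [Field L] (σ : K →+* L) {τ : Type*}
    (a b : MvPolynomial τ K) : multiplicity (map σ a) (map σ b) = multiplicity a b :=
  multiplicity_eq_of_emultiplicity_eq <| emultiplicity_eq_emultiplicity_iff.2 fun n => by
    rw [← map_pow, map_dvd_map_iff]

end Descent

end Dynatomic

namespace Dynatomic

open MvPolynomial

section Order

variable {K : Type*} [Field K]

lemma associated_vecForm_smul {c : K} (hc : c ≠ 0) (v : Fin 2 → K) :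
    Associated (vecForm v) (vecForm (c • v)) := by
  rw [vecForm_smul]
  exact associated_unit_mul_right _ _ ((isUnit_iff_ne_zero.2 hc).map C)

lemma associated_linearForm_mk {v : Fin 2 → K} (hv : v ≠ 0) :
    Associated (linearForm (Projectivization.mk K v hv)) (vecForm v) := by
  obtain ⟨a, ha⟩ := Projectivization.exists_smul_eq_mk_rep K v hv
  rw [linearForm_eq_vecForm, ← ha]
  exact (associated_vecForm_smul a.ne_zero v).symm

lemma linearForm_dvd_linearForm {P Q : ℙ K (Fin 2 → K)} : linearForm Q ∣ linearForm P ↔ P = Q := by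
  refine ⟨fun h => ?_, fun h => h ▸ dvd_rfl⟩
  have h0 := eval_eq_zero_of_vecForm_dvd h
  rw [linearForm_eq_vecForm, eval_vecForm, sub_eq_zero] at h0
  rw [← Projectivization.mk_rep P, ← Projectivization.mk_rep Q, Projectivization.mk_eq_mk_iff']
  obtain ⟨i, hi⟩ := exists_apply_ne_zero Q.rep_nonzero
  refine ⟨P.rep i / Q.rep i, funext fun j => ?_⟩
  rw [Pi.smul_apply, smul_eq_mul, div_mul_eq_mul_div, div_eq_iff hi]
  fin_cases i <;> fin_cases j <;> simp only [Fin.zero_eta, Fin.mk_one]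
  · exact h0.symm
  · exact h0

lemma ordAt_div (Q : ℙ K (Fin 2 → K)) {a b : MvPolynomial (Fin 2) K} (ha : a ≠ 0) (hb : b ≠ 0) :
    ordAt Q (algebraMap _ (RatFun K) a / algebraMap _ (RatFun K) b) =
      (multiplicity (linearForm Q) a : ℤ) - multiplicity (linearForm Q) b := by
  set f : RatFun K := algebraMap _ (RatFun K) a / algebraMap _ (RatFun K) b with hf
  have inj := IsFractionRing.injective (MvPolynomial (Fin 2) K) (RatFun K)
  have hb' : algebraMap _ (RatFun K) b ≠ 0 := (map_ne_zero_iff _ inj).2 hb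
  have hf0 : f ≠ 0 := div_ne_zero ((map_ne_zero_iff _ inj).2 ha) hb'
  have hd : (IsFractionRing.den (MvPolynomial (Fin 2) K) f : MvPolynomial (Fin 2) K) ≠ 0 :=
    nonZeroDivisors.ne_zero (SetLike.coe_mem _)
  have hd' : algebraMap _ (RatFun K)
      (IsFractionRing.den (MvPolynomial (Fin 2) K) f : MvPolynomial (Fin 2) K) ≠ 0 :=
    (map_ne_zero_iff _ inj).2 hd
  have hnd : algebraMap _ (RatFun K) (IsFractionRing.num (MvPolynomial (Fin 2) K) f) /
      algebraMap _ (RatFun K)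
        (IsFractionRing.den (MvPolynomial (Fin 2) K) f : MvPolynomial (Fin 2) K) = f := by
    rw [← IsFractionRing.mk'_eq_div, IsFractionRing.mk'_num_den]
  have hn : IsFractionRing.num (MvPolynomial (Fin 2) K) f ≠ 0 := by
    intro h; rw [h, map_zero, zero_div] at hnd; exact hf0 hnd.symm
  rw [← hnd, div_eq_div_iff hd' hb', ← map_mul, ← map_mul] at hf
  have key := congrArg (multiplicity (linearForm Q)) (inj hf)
  rw [multiplicity_mul_of_ne_zero (linearForm_prime Q) hn hb,
    multiplicity_mul_of_ne_zero (linearForm_prime Q) ha hd] at key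
  rw [ordAt]
  omega

lemma exists_eq_div {f : RatFun K} (hf : f ≠ 0) : ∃ a b : MvPolynomial (Fin 2) K,
    a ≠ 0 ∧ b ≠ 0 ∧ f = algebraMap _ (RatFun K) a / algebraMap _ (RatFun K) b := by
  obtain ⟨a, b, hb, rfl⟩ := IsFractionRing.div_surjective (A := MvPolynomial (Fin 2) K) f
  refine ⟨a, b, ?_, nonZeroDivisors.ne_zero hb, rfl⟩
  rintro rfl; simp at hf

lemma ordAt_algebraMap (Q : ℙ K (Fin 2 → K)) {a : MvPolynomial (Fin 2) K} (ha : a ≠ 0) :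
    ordAt Q (algebraMap _ (RatFun K) a) = multiplicity (linearForm Q) a := by
  have := ordAt_div Q ha one_ne_zero
  rwa [map_one, div_one, multiplicity_of_one_right (linearForm_prime Q).not_isUnit, Nat.cast_zero,
    sub_zero] at this

lemma ordAt_mul (Q : ℙ K (Fin 2 → K)) {f g : RatFun K} (hf : f ≠ 0) (hg : g ≠ 0) :
    ordAt Q (f * g) = ordAt Q f + ordAt Q g := by
  obtain ⟨a, b, ha, hb, rfl⟩ := exists_eq_div hf
  obtain ⟨c, d, hc, hd, rfl⟩ := exists_eq_div hg
  rw [div_mul_div_comm, ← map_mul, ← map_mul, ordAt_div Q ha hb, ordAt_div Q hc hd,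
    ordAt_div Q (mul_ne_zero ha hc) (mul_ne_zero hb hd),
    multiplicity_mul_of_ne_zero (linearForm_prime Q) ha hc,
    multiplicity_mul_of_ne_zero (linearForm_prime Q) hb hd]
  push_cast; ring

/-- The order along the linear form of `Q`, as a homomorphism. -/
noncomputable def ordHom (Q : ℙ K (Fin 2 → K)) : (RatFun K)ˣ →* Multiplicative ℤ :=
  MonoidHom.mk' (fun f => Multiplicative.ofAdd (ordAt Q f)) fun f g => by
    rw [Units.val_mul, ordAt_mul Q f.ne_zero g.ne_zero, ofAdd_add]

lemma ordAt_eq_toAdd_ordHom (Q : ℙ K (Fin 2 → K)) {f : RatFun K} (hf : f ≠ 0) :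
    ordAt Q f = (ordHom Q (Units.mk0 f hf)).toAdd := rfl

lemma ordAt_zpow (Q : ℙ K (Fin 2 → K)) {f : RatFun K} (hf : f ≠ 0) (n : ℤ) :
    ordAt Q (f ^ n) = n * ordAt Q f := by
  rw [ordAt_eq_toAdd_ordHom Q (zpow_ne_zero n hf), ordAt_eq_toAdd_ordHom Q hf, ← smul_eq_mul,
    ← toAdd_zpow, ← map_zpow]
  congr 2
  ext; simp

lemma ordAt_one (Q : ℙ K (Fin 2 → K)) : ordAt Q (1 : RatFun K) = 0 := by
  simpa using ordAt_zpow Q (one_ne_zero (α := RatFun K)) 0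

lemma ordAt_div' (Q : ℙ K (Fin 2 → K)) {f g : RatFun K} (hf : f ≠ 0) (hg : g ≠ 0) :
    ordAt Q (f / g) = ordAt Q f - ordAt Q g := by
  rw [div_eq_mul_inv, ordAt_mul Q hf (inv_ne_zero hg), ← zpow_neg_one, ordAt_zpow Q hg]; ring

lemma ordAt_prod (Q : ℙ K (Fin 2 → K)) {ι : Type*} (s : Finset ι) {f : ι → RatFun K}
    (hf : ∀ i ∈ s, f i ≠ 0) : ordAt Q (∏ i ∈ s, f i) = ∑ i ∈ s, ordAt Q (f i) := by
  classical
  induction s using Finset.induction_on with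
  | empty => simp [ordAt_one]
  | insert i s hi ih =>
    have hs : ∀ j ∈ s, f j ≠ 0 := fun j hj => hf j (Finset.mem_insert_of_mem hj)
    rw [Finset.prod_insert hi, Finset.sum_insert hi, ordAt_mul Q (hf i (Finset.mem_insert_self i s))
      (Finset.prod_ne_zero_iff.2 hs), ih hs]

lemma ordAt_linearForm [DecidableEq (ℙ K (Fin 2 → K))] (P Q : ℙ K (Fin 2 → K)) :
    ordAt Q (algebraMap _ (RatFun K) (linearForm P)) = if P = Q then 1 else 0 := by
  rw [ordAt_algebraMap Q (linearForm_prime P).ne_zero]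
  split_ifs with h
  · rw [h, multiplicity_self]; rfl
  · rw [multiplicity_eq_zero.2 (mt linearForm_dvd_linearForm.1 h)]; rfl

end Order

section BaseChange

variable {K L : Type*} [Field K] [Field L] (σ : K →+* L)

/-- Base change of rational functions along a field homomorphism. -/
noncomputable def ratMap : RatFun K →+* RatFun L :=
  IsFractionRing.lift (A := MvPolynomial (Fin 2) K)
    (g := (algebraMap (MvPolynomial (Fin 2) L) (RatFun L)).comp (MvPolynomial.map σ))
    ((IsFractionRing.injective _ _).comp (map_injective σ σ.injective))

@[simp]
lemma ratMap_algebraMap (a : MvPolynomial (Fin 2) K) :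
    ratMap σ (algebraMap _ (RatFun K) a) = algebraMap _ (RatFun L) (MvPolynomial.map σ a) :=
  IsFractionRing.lift_algebraMap _ a

lemma map_vecForm (v : Fin 2 → K) : MvPolynomial.map σ (vecForm v) = vecForm (σ ∘ v) := by
  simp [vecForm]

/-- Base change of points of the projective line. -/
noncomputable def pointMap (P : ℙ K (Fin 2 → K)) : ℙ L (Fin 2 → L) :=
  Projectivization.mk L (σ ∘ P.rep) fun h => P.rep_nonzero <| funext fun i =>
    σ.injective ((congrFun h i).trans (map_zero σ).symm)

lemma associated_linearForm_pointMap (P : ℙ K (Fin 2 → K)) :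
    Associated (linearForm (pointMap σ P)) (MvPolynomial.map σ (linearForm P)) := by
  rw [linearForm_eq_vecForm P, map_vecForm]
  exact associated_linearForm_mk _

lemma ordAt_pointMap (P : ℙ K (Fin 2 → K)) {f : RatFun K} (hf : f ≠ 0) :
    ordAt (pointMap σ P) (ratMap σ f) = ordAt P f := by
  obtain ⟨a, b, ha, hb, rfl⟩ := exists_eq_div hf
  have inj := map_injective σ σ.injective (σ := Fin 2)
  rw [map_div₀, ratMap_algebraMap, ratMap_algebraMap, ordAt_div P ha hb,
    ordAt_div _ ((map_ne_zero_iff _ inj).2 ha) ((map_ne_zero_iff _ inj).2 hb)]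
  simp_rw [← multiplicity_eq_of_associated_left (associated_linearForm_pointMap σ P),
    multiplicity_map]

lemma ordAt_ratMap_linearForm [DecidableEq (ℙ L (Fin 2 → L))] (P : ℙ K (Fin 2 → K))
    (Q : ℙ L (Fin 2 → L)) :
    ordAt Q (ratMap σ (algebraMap _ (RatFun K) (linearForm P))) =
      if pointMap σ P = Q then 1 else 0 := by
  have h := associated_linearForm_pointMap σ P
  have h0 := (linearForm_prime (pointMap σ P)).ne_zero
  rw [ratMap_algebraMap, ← ordAt_linearForm, ordAt_algebraMap Q h0,
    ordAt_algebraMap Q (h.ne_zero_iff.1 h0), multiplicity_eq_of_associated_right h]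

end BaseChange

section HomogeneousFraction

variable {K L : Type*} [Field K] [Field L]

/-- A nonzero quotient of homogeneous polynomials. -/
def IsHomogeneousFraction (f : RatFun K) : Prop :=
  ∃ (m n : ℕ) (a b : MvPolynomial (Fin 2) K), a.IsHomogeneous m ∧ b.IsHomogeneous n ∧ a ≠ 0 ∧
    b ≠ 0 ∧ f = algebraMap _ (RatFun K) a / algebraMap _ (RatFun K) b

namespace IsHomogeneousFraction

lemma of_isHomogeneous {n : ℕ} {a : MvPolynomial (Fin 2) K} (ha : a.IsHomogeneous n)
    (h0 : a ≠ 0) : IsHomogeneousFraction (algebraMap _ (RatFun K) a) :=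
  ⟨n, 0, a, 1, ha, isHomogeneous_one _ _, h0, one_ne_zero, by simp⟩

lemma one : IsHomogeneousFraction (1 : RatFun K) := by
  simpa using of_isHomogeneous (isHomogeneous_one (Fin 2) K) one_ne_zero

lemma mul {f g : RatFun K} (hf : IsHomogeneousFraction f) (hg : IsHomogeneousFraction g) :
    IsHomogeneousFraction (f * g) := by
  obtain ⟨m, n, a, b, ha, hb, ha0, hb0, rfl⟩ := hf
  obtain ⟨m', n', a', b', ha', hb', ha0', hb0', rfl⟩ := hg
  exact ⟨_, _, a * a', b * b', ha.mul ha', hb.mul hb', mul_ne_zero ha0 ha0', mul_ne_zero hb0 hb0',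
    by rw [div_mul_div_comm, map_mul, map_mul]⟩

lemma inv {f : RatFun K} (hf : IsHomogeneousFraction f) : IsHomogeneousFraction f⁻¹ := by
  obtain ⟨m, n, a, b, ha, hb, ha0, hb0, rfl⟩ := hf
  exact ⟨n, m, b, a, hb, ha, hb0, ha0, inv_div _ _⟩

lemma div {f g : RatFun K} (hf : IsHomogeneousFraction f) (hg : IsHomogeneousFraction g) :
    IsHomogeneousFraction (f / g) := by
  rw [div_eq_mul_inv]; exact hf.mul hg.inv

lemma pow {f : RatFun K} (hf : IsHomogeneousFraction f) (n : ℕ) :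
    IsHomogeneousFraction (f ^ n) := by
  induction n with
  | zero => simpa using one
  | succ n ih => rw [pow_succ]; exact ih.mul hf

lemma zpow {f : RatFun K} (hf : IsHomogeneousFraction f) (n : ℤ) :
    IsHomogeneousFraction (f ^ n) := by
  cases n with
  | ofNat n => simpa using hf.pow n
  | negSucc n => rw [zpow_negSucc]; exact (hf.pow _).inv

lemma prod {ι : Type*} (s : Finset ι) {f : ι → RatFun K}
    (hf : ∀ i ∈ s, IsHomogeneousFraction (f i)) : IsHomogeneousFraction (∏ i ∈ s, f i) :=
  Finset.prod_induction f _ (fun _ _ => mul) one hf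

lemma ne_zero {f : RatFun K} (hf : IsHomogeneousFraction f) : f ≠ 0 := by
  obtain ⟨m, n, a, b, ha, hb, ha0, hb0, rfl⟩ := hf
  have inj := IsFractionRing.injective (MvPolynomial (Fin 2) K) (RatFun K)
  exact div_ne_zero ((map_ne_zero_iff _ inj).2 ha0) ((map_ne_zero_iff _ inj).2 hb0)

lemma exists_algebraMap_eq [IsAlgClosed L] (σ : K →+* L) {f : RatFun K}
    (hf : IsHomogeneousFraction f) (h : ∀ Q, 0 ≤ ordAt Q (ratMap σ f)) :
    ∃ A, algebraMap (MvPolynomial (Fin 2) K) (RatFun K) A = f := by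
  obtain ⟨m, n, a, b, ha, hb, ha0, hb0, rfl⟩ := hf
  have inj := map_injective σ σ.injective (σ := Fin 2)
  have ha1 := (map_ne_zero_iff _ inj).2 ha0
  have hb1 := (map_ne_zero_iff _ inj).2 hb0
  have hdvd : b ∣ a := by
    refine dvd_of_map_dvd_map σ (dvd_of_multiplicity_le (hb.map σ) hb1 ha1 fun v hv => ?_)
    have := h (Projectivization.mk L v hv)
    rw [map_div₀, ratMap_algebraMap, ratMap_algebraMap, ordAt_div _ ha1 hb1,
      ← multiplicity_eq_of_associated_left (associated_linearForm_mk hv),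
      ← multiplicity_eq_of_associated_left (associated_linearForm_mk hv)] at this
    omega
  obtain ⟨c, rfl⟩ := hdvd
  refine ⟨c, ?_⟩
  rw [map_mul, mul_div_cancel_left₀]
  exact (map_ne_zero_iff _ (IsFractionRing.injective _ _)).2 hb0

end IsHomogeneousFraction

end HomogeneousFraction

end Dynatomic

namespace Dynatomic

open MvPolynomial Pair

section Agreement

variable {K : Type*} [Field K]

namespace Pair

/-- The pair `[u F₀ : u F₁]`. -/
noncomputable def scale (u : K) (F : Pair K) : Pair K := fun i => C u * F i

/-- The entries of `F` have no common zero in `ℙ¹(K)`. -/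
def NoCommonZero (F : Pair K) : Prop := ∀ v : Fin 2 → K, v ≠ 0 → ∃ i, eval v (F i) ≠ 0

lemma comp_assoc (A B D : Pair K) : (A.comp B).comp D = A.comp (B.comp D) := by
  ext1 i
  simp only [comp, bind₁_bind₁]
  rfl

lemma X_comp (F : Pair K) : comp (X : Pair K) F = F := by
  ext1 i
  simp only [comp, bind₁_X_right]

lemma comp_X (F : Pair K) : F.comp X = F := funext fun i => by
  change bind₁ X (F i) = F i
  rw [bind₁_X_left]; rfl

lemma eval_comp (v : Fin 2 → K) (F G : Pair K) (i : Fin 2) :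
    eval v (F.comp G i) = eval (fun j => eval v (G j)) (F i) := by
  change eval₂Hom (RingHom.id K) v (bind₁ G (F i)) = _
  rw [eval₂Hom_bind₁]; rfl

lemma NoCommonZero.comp {F G : Pair K} (hF : F.NoCommonZero) (hG : G.NoCommonZero) :
    (F.comp G).NoCommonZero := fun v hv => by
  obtain ⟨i, hi⟩ := hG v hv
  obtain ⟨j, hj⟩ := hF (fun j => eval v (G j)) (fun h => hi (congrFun h i))
  exact ⟨j, by rwa [eval_comp]⟩

lemma isHomogeneous_comp {m n : ℕ} {F G : Pair K} (hF : ∀ i, (F i).IsHomogeneous m)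
    (hG : ∀ i, (G i).IsHomogeneous n) (i : Fin 2) : (F.comp G i).IsHomogeneous (n * m) :=
  (hF i).aeval G hG

lemma isHomogeneous_iter {d : ℕ} {φ : Pair K} (hφ : ∀ i, (φ i).IsHomogeneous d) (k : ℕ) :
    ∀ i, (φ.iter k i).IsHomogeneous (d ^ k) := by
  induction k with
  | zero => exact fun i => isHomogeneous_X K i
  | succ k ih => intro i; rw [pow_succ']; exact isHomogeneous_comp ih hφ i

lemma noCommonZero_X : NoCommonZero (X : Pair K) := fun v hv => by
  simpa using exists_apply_ne_zero hv

lemma NoCommonZero.iter {φ : Pair K} (hφ : φ.NoCommonZero) (k : ℕ) : (φ.iter k).NoCommonZero := by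
  induction k with
  | zero => exact noCommonZero_X
  | succ k ih => exact ih.comp hφ

lemma iter_add (φ : Pair K) (m k : ℕ) : φ.iter (m + k) = (φ.iter m).comp (φ.iter k) := by
  induction k with
  | zero => exact (comp_X _).symm
  | succ k ih => rw [← add_assoc, Pair.iter, ih, comp_assoc]; rfl

lemma scale_comp (u : K) (F G : Pair K) : (scale u F).comp G = scale u (F.comp G) :=
  funext fun i => by simp [scale, comp]

lemma scale_scale (u w : K) (F : Pair K) : scale u (scale w F) = scale (u * w) F :=
  funext fun i => by simp [scale, mul_assoc]

lemma scale_one (F : Pair K) : scale 1 F = F := funext fun i => by simp [scale]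

lemma comp_scale {n : ℕ} {F : Pair K} (hF : ∀ i, (F i).IsHomogeneous n) (u : K) (G : Pair K) :
    F.comp (scale u G) = scale (u ^ n) (F.comp G) := funext fun i => by
  have := aeval_mul_left (hF i) (C u) G
  rwa [← C_pow] at this

lemma ofMatrix_isHomogeneous (g : GL (Fin 2) K) (i : Fin 2) :
    (ofMatrix g i).IsHomogeneous 1 :=
  IsHomogeneous.sum _ _ _ fun _ _ => isHomogeneous_C_mul_X _ _

lemma eval_ofMatrix (g : GL (Fin 2) K) (v : Fin 2 → K) (i : Fin 2) :
    eval v (ofMatrix g i) = g.1.mulVec v i := by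
  simp [ofMatrix, Matrix.mulVec, dotProduct]

lemma ofMatrix_one : ofMatrix (1 : GL (Fin 2) K) = X := by
  ext1 i
  fin_cases i <;> simp [ofMatrix]

lemma ofMatrix_mul (g g' : GL (Fin 2) K) :
    ofMatrix (g * g') = (ofMatrix g).comp (ofMatrix g') := by
  ext1 i
  simp only [ofMatrix, comp, Units.val_mul, Matrix.mul_apply, Fin.sum_univ_two, map_add, map_mul,
    bind₁_X_right, bind₁_C_right]
  ring

lemma ofMatrix_scalar (u : Kˣ) : ofMatrix (Matrix.GeneralLinearGroup.scalar (Fin 2) u) =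
    scale (u : K) X := by
  ext1 i
  fin_cases i <;> simp [ofMatrix, scale]

lemma noCommonZero_ofMatrix (g : GL (Fin 2) K) : (ofMatrix g).NoCommonZero := fun v hv => by
  simp_rw [eval_ofMatrix]
  refine exists_apply_ne_zero fun h => hv ?_
  have := congrArg (g⁻¹.1.mulVec) h
  rwa [Matrix.mulVec_mulVec, ← Units.val_mul, inv_mul_cancel, Units.val_one, Matrix.one_mulVec,
    Matrix.mulVec_zero] at this

lemma diff_swap (F G : Pair K) : diff G F = -diff F G := by
  simp only [diff]; ring

lemma diff_scale_left (u : K) (F G : Pair K) : diff (scale u F) G = C u * diff F G := by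
  simp only [diff, scale]; ring

lemma diff_scale_right (u : K) (F G : Pair K) : diff F (scale u G) = C u * diff F G := by
  simp only [diff, scale]; ring

lemma diff_ofMatrix_comp (g : GL (Fin 2) K) (F G : Pair K) :
    diff ((ofMatrix g).comp F) ((ofMatrix g).comp G) = C g.1.det * diff F G := by
  simp only [diff, ofMatrix, comp, Fin.sum_univ_two, map_add, map_mul, bind₁_X_right,
    bind₁_C_right, Matrix.det_fin_two, map_sub]
  ring

lemma isHomogeneous_diff {m n : ℕ} {F G : Pair K} (hF : ∀ i, (F i).IsHomogeneous m)
    (hG : ∀ i, (G i).IsHomogeneous n) : (diff F G).IsHomogeneous (n + m) :=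
  ((hG 1).mul (hF 0)).sub ((hG 0).mul (hF 1))

lemma diff_ofMatrix_ne_zero [IsAlgClosed K] {n : ℕ} (hn : 2 ≤ n) {F : Pair K}
    (hF : ∀ i, (F i).IsHomogeneous n) (hF0 : F.NoCommonZero) (g : GL (Fin 2) K) :
    diff F (ofMatrix g) ≠ 0 := by
  intro h
  have h1 := diff_ofMatrix_comp g⁻¹ F (ofMatrix g)
  rw [h, mul_zero, ← ofMatrix_mul, inv_mul_cancel, ofMatrix_one] at h1
  have hE : ∀ i, ((ofMatrix g⁻¹).comp F i).IsHomogeneous n := fun i => by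
    simpa using isHomogeneous_comp (ofMatrix_isHomogeneous g⁻¹) hF i
  have hE0 := (noCommonZero_ofMatrix g⁻¹).comp hF0
  set E := (ofMatrix g⁻¹).comp F
  rw [diff, sub_eq_zero] at h1
  have hX : ¬ (X 0 : MvPolynomial (Fin 2) K) ∣ X 1 := by
    rw [X_dvd_X]; simp
  obtain ⟨G, hG⟩ : X 0 ∣ E 0 :=
    ((X_prime (i := 0)).dvd_or_dvd (Dvd.intro _ h1.symm)).resolve_left hX
  have hG1 : E 1 = X 1 * G := by
    rw [hG] at h1
    exact mul_left_cancel₀ (X_ne_zero (R := K) (0 : Fin 2)) (by rw [← h1]; ring)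
  have hGh : G.IsHomogeneous (n - 1) := by
    refine isHomogeneous_of_mul (isHomogeneous_X K 0) (X_ne_zero 0) ?_
    rw [← hG, Nat.add_sub_cancel' (by omega)]
    exact hE 0
  obtain ⟨v, hv, hGv⟩ := exists_eval_eq_zero (by omega) hGh
  obtain ⟨i, hi⟩ := hE0 v hv
  fin_cases i <;> simp [hG, hG1, hGv] at hi

lemma pow_dvd_diff_trans {l : MvPolynomial (Fin 2) K} (hl : Prime l) {F G H : Pair K}
    (hG : ∃ i, ¬ l ∣ G i) {e : ℕ} (h₁ : l ^ e ∣ diff F G) (h₂ : l ^ e ∣ diff G H) :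
    l ^ e ∣ diff F H := by
  obtain ⟨i, hi⟩ := hG
  refine hl.pow_dvd_of_dvd_mul_left e hi ?_
  have : G i * diff F H = H i * diff F G + F i * diff G H := by
    fin_cases i <;> simp [diff] <;> ring
  rw [this]
  exact dvd_add (dvd_mul_of_dvd_right h₁ _) (dvd_mul_of_dvd_right h₂ _)

lemma pow_dvd_diff_comp {l : MvPolynomial (Fin 2) K} (hl : Prime l) {n : ℕ} {A F G : Pair K}
    (hA : ∀ i, (A i).IsHomogeneous n) (hG : ∃ i, ¬ l ∣ G i) {e : ℕ} (h : l ^ e ∣ diff F G) :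
    l ^ e ∣ diff (A.comp F) (A.comp G) := by
  obtain ⟨i, hi⟩ := hG
  refine hl.pow_dvd_of_dvd_mul_left e (mt hl.dvd_of_dvd_pow hi : ¬ l ∣ G i ^ n) ?_
  have h' : l ^ e ∣ F 0 * G 1 - F 1 * G 0 := by convert h using 1; rw [diff]; ring
  have key : ∀ j, l ^ e ∣ G i ^ n * A.comp F j - F i ^ n * A.comp G j := fun j =>
    dvd_pow_mul_aeval_sub h' (hA j) i
  have : G i ^ n * diff (A.comp F) (A.comp G) =
      A.comp G 1 * (G i ^ n * A.comp F 0 - F i ^ n * A.comp G 0) -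
        A.comp G 0 * (G i ^ n * A.comp F 1 - F i ^ n * A.comp G 1) := by
    rw [diff]; ring
  rw [this]
  exact dvd_sub (dvd_mul_of_dvd_right (key 0) _) (dvd_mul_of_dvd_right (key 1) _)

lemma NoCommonZero.exists_not_dvd {F : Pair K} (hF : F.NoCommonZero) {v : Fin 2 → K}
    (hv : v ≠ 0) : ∃ i, ¬ vecForm v ∣ F i :=
  (hF v hv).imp fun _ => mt eval_eq_zero_of_vecForm_dvd

/-- The matrices commuting with `φ` up to a nonzero constant. -/
def commutant {d : ℕ} {φ : Pair K} (_ : ∀ i, (φ i).IsHomogeneous d) : Subgroup (GL (Fin 2) K) where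
  carrier := {g | ∃ u : K, u ≠ 0 ∧ φ.comp (ofMatrix g) = scale u ((ofMatrix g).comp φ)}
  one_mem' := ⟨1, one_ne_zero, by rw [ofMatrix_one, comp_X, X_comp, scale_one]⟩
  mul_mem' := by
    rintro g g' ⟨u, hu, h⟩ ⟨u', hu', h'⟩
    refine ⟨u * u', mul_ne_zero hu hu', ?_⟩
    rw [ofMatrix_mul, ← comp_assoc, h, scale_comp, comp_assoc, h',
      comp_scale (ofMatrix_isHomogeneous g), pow_one, scale_scale, comp_assoc]
  inv_mem' := by
    rintro g ⟨u, hu, h⟩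
    refine ⟨u⁻¹, inv_ne_zero hu, ?_⟩
    have h1 : (ofMatrix g⁻¹).comp φ = (ofMatrix g⁻¹).comp ((φ.comp (ofMatrix g)).comp
        (ofMatrix g⁻¹)) := by
      rw [comp_assoc, ← ofMatrix_mul, mul_inv_cancel, ofMatrix_one, comp_X]
    rw [h1, h, scale_comp, comp_scale (ofMatrix_isHomogeneous _), pow_one, scale_scale,
      inv_mul_cancel₀ hu, scale_one, comp_assoc, ← comp_assoc, ← ofMatrix_mul, inv_mul_cancel,
      ofMatrix_one, X_comp]

lemma HasAut.mem_commutant {d : ℕ} {φ : Pair K} (hφ : ∀ i, (φ i).IsHomogeneous d)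
    {h : GL (Fin 2) K} (hh : φ.HasAut h) : h ∈ commutant hφ := by
  obtain ⟨u, hu, hh⟩ := hh
  refine ⟨u, hu, ?_⟩
  have h1 := congrArg (ofMatrix h).comp hh
  rw [← comp_assoc, ← ofMatrix_mul, mul_inv_cancel, ofMatrix_one, X_comp] at h1
  rw [h1]
  exact (comp_scale (ofMatrix_isHomogeneous h) u φ).trans (by rw [pow_one])

lemma iter_comp_ofMatrix {d : ℕ} {φ : Pair K} (hφ : ∀ i, (φ i).IsHomogeneous d)
    {g : GL (Fin 2) K} (hg : g ∈ commutant hφ) (k : ℕ) :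
    ∃ u : K, u ≠ 0 ∧ (φ.iter k).comp (ofMatrix g) = scale u ((ofMatrix g).comp (φ.iter k)) := by
  induction k with
  | zero => exact ⟨1, one_ne_zero, by rw [scale_one]; exact (X_comp _).trans (comp_X _).symm⟩
  | succ k ih =>
    obtain ⟨u, hu, h⟩ := hg
    obtain ⟨w, hw, h'⟩ := ih
    refine ⟨u ^ d ^ k * w, mul_ne_zero (pow_ne_zero _ hu) hw, ?_⟩
    rw [Pair.iter, comp_assoc, h, comp_scale (isHomogeneous_iter hφ k), ← comp_assoc, h',
      scale_comp, scale_scale, comp_assoc]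

section Iterates

variable {d : ℕ} {φ : Pair K} (hφ : ∀ i, (φ i).IsHomogeneous d) (hφ0 : φ.NoCommonZero)
  {v : Fin 2 → K} (hv : v ≠ 0) {e : ℕ}

include hφ0 hv in
lemma pow_dvd_diff_iter_add {g g' : GL (Fin 2) K} (hg' : g' ∈ commutant hφ) {k m : ℕ}
    (h : vecForm v ^ e ∣ diff (φ.iter k) (ofMatrix g))
    (h' : vecForm v ^ e ∣ diff (φ.iter m) (ofMatrix g')) :
    vecForm v ^ e ∣ diff (φ.iter (k + m)) (ofMatrix (g' * g)) := by
  have hl := vecForm_prime hv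
  obtain ⟨u, hu, hc⟩ := iter_comp_ofMatrix hφ hg' k
  have h1 := pow_dvd_diff_comp hl (isHomogeneous_iter hφ k)
    ((noCommonZero_ofMatrix g').exists_not_dvd hv) h'
  have h2 := pow_dvd_diff_comp hl (ofMatrix_isHomogeneous g')
    ((noCommonZero_ofMatrix g).exists_not_dvd hv) h
  rw [hc, diff_scale_right, ((isUnit_iff_ne_zero.2 hu).map C).dvd_mul_left] at h1
  rw [iter_add, ofMatrix_mul]
  exact pow_dvd_diff_trans hl
    (((noCommonZero_ofMatrix g').comp (hφ0.iter k)).exists_not_dvd hv) h1 h2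

include hφ0 hv in
lemma pow_dvd_diff_iter_sub {g g' : GL (Fin 2) K} (hg' : g' ∈ commutant hφ) {k m : ℕ}
    (h : vecForm v ^ e ∣ diff (φ.iter (k + m)) (ofMatrix g))
    (h' : vecForm v ^ e ∣ diff (φ.iter m) (ofMatrix g')) :
    vecForm v ^ e ∣ diff (φ.iter k) (ofMatrix (g'⁻¹ * g)) := by
  have hl := vecForm_prime hv
  obtain ⟨u, hu, hc⟩ := iter_comp_ofMatrix hφ hg' k
  have h1 := pow_dvd_diff_comp hl (isHomogeneous_iter hφ k)
    ((noCommonZero_ofMatrix g').exists_not_dvd hv) h'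
  rw [hc, diff_scale_right, ((isUnit_iff_ne_zero.2 hu).map C).dvd_mul_left, ← iter_add,
    ← dvd_neg, ← diff_swap] at h1
  have h2 := pow_dvd_diff_trans hl ((hφ0.iter (k + m)).exists_not_dvd hv) h1 h
  have h3 := pow_dvd_diff_comp hl (ofMatrix_isHomogeneous g'⁻¹)
    ((noCommonZero_ofMatrix g).exists_not_dvd hv) h2
  rwa [← comp_assoc, ← ofMatrix_mul, inv_mul_cancel, ofMatrix_one, X_comp, ← ofMatrix_mul] at h3

include hφ0 hv in
lemma pow_dvd_diff_iter_mul {g : GL (Fin 2) K} (hg : g ∈ commutant hφ) {k : ℕ}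
    (h : vecForm v ^ e ∣ diff (φ.iter k) (ofMatrix g)) (n : ℕ) :
    vecForm v ^ e ∣ diff (φ.iter (n * k)) (ofMatrix (g ^ n)) := by
  induction n with
  | zero => rw [pow_zero, ofMatrix_one, zero_mul, Pair.iter, diff, mul_comm, sub_self]
            exact dvd_zero _
  | succ n ih =>
    rw [pow_succ', add_mul, one_mul]
    exact pow_dvd_diff_iter_add hφ hφ0 hv hg ih h

end Iterates

end Pair

lemma exists_mem_iff_dvd {S : Set ℕ} (h0 : 0 ∈ S) (hadd : ∀ a ∈ S, ∀ b ∈ S, a + b ∈ S)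
    (hsub : ∀ a b, a + b ∈ S → b ∈ S → a ∈ S) : ∃ t, ∀ k, k ∈ S ↔ t ∣ k := by
  classical
  by_cases h : ∃ k, k ∈ S ∧ 0 < k
  · obtain ⟨ht, htpos⟩ := Nat.find_spec h
    have hmin : ∀ r < Nat.find h, ¬ (r ∈ S ∧ 0 < r) := fun _ => Nat.find_min h
    set t := Nat.find h
    have hmul : ∀ n, t * n ∈ S := fun n => by
      induction n with
      | zero => exact h0
      | succ n ih => exact hadd _ ih _ ht
    refine ⟨t, fun k => ⟨fun hk => ?_, fun ⟨n, hn⟩ => hn ▸ hmul n⟩⟩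
    have hr : k % t ∈ S := hsub _ (t * (k / t)) (by rwa [Nat.mod_add_div]) (hmul _)
    by_contra hdvd
    exact hmin _ (Nat.mod_lt k htpos) ⟨hr, Nat.pos_of_ne_zero (mt Nat.dvd_of_mod_eq_zero hdvd)⟩
  · push Not at h
    exact ⟨0, fun k => by
      rw [zero_dvd_iff]
      exact ⟨fun hk => Nat.le_zero.1 (h k hk), fun hk => hk ▸ h0⟩⟩

/-- The iterates agreeing with an element of `H` to a given order are those whose index is
divisible by some `t`. -/
lemma exists_agreement_iff_dvd {d : ℕ} {φ : Pair K} (hφ : ∀ i, (φ i).IsHomogeneous d)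
    (hφ0 : φ.NoCommonZero) {v : Fin 2 → K} (hv : v ≠ 0) (e : ℕ) {H : Subgroup (GL (Fin 2) K)}
    (hH : H ≤ commutant hφ) :
    ∃ t, ∀ k, (∃ g ∈ H, vecForm v ^ e ∣ diff (φ.iter k) (ofMatrix g)) ↔ t ∣ k := by
  refine exists_mem_iff_dvd
    (S := {k | ∃ g ∈ H, vecForm v ^ e ∣ diff (φ.iter k) (ofMatrix g)}) ⟨1, H.one_mem, ?_⟩ ?_ ?_
  · rw [ofMatrix_one, Pair.iter, diff, mul_comm, sub_self]
    exact dvd_zero _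
  · rintro k ⟨g, hg, h⟩ m ⟨g', hg', h'⟩
    exact ⟨_, H.mul_mem hg' hg, pow_dvd_diff_iter_add hφ hφ0 hv (hH hg') h h'⟩
  · rintro k m ⟨g, hg, h⟩ ⟨g', hg', h'⟩
    exact ⟨_, H.mul_mem (H.inv_mem hg') hg, pow_dvd_diff_iter_sub hφ hφ0 hv (hH hg') h h'⟩

end Agreement

section Moebius

open ArithmeticFunction

lemma sum_divisors_moebius (m : ℕ) :
    ∑ k ∈ m.divisors, moebius (m / k) = if m = 1 then 1 else 0 := by
  rw [Nat.sum_div_divisors m fun k => moebius k, ← coe_mul_zeta_apply, moebius_mul_coe_zeta,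
    one_apply]

lemma sum_filter_dvd_moebius {N t : ℕ} (hN : N ≠ 0) :
    ∑ k ∈ N.divisors with t ∣ k, moebius (N / k) = if t = N then 1 else 0 := by
  by_cases ht : t ∣ N
  · obtain ⟨m, rfl⟩ := ht
    have ht0 := left_ne_zero_of_mul hN
    have hm0 := right_ne_zero_of_mul hN
    have himg : {k ∈ (t * m).divisors | t ∣ k} = m.divisors.map
        ⟨(t * ·), mul_right_injective₀ ht0⟩ := by
      ext k
      simp only [Finset.mem_filter, Nat.mem_divisors, Finset.mem_map, Function.Embedding.coeFn_mk]
      constructor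
      · rintro ⟨⟨h, -⟩, j, rfl⟩
        exact ⟨j, ⟨(mul_dvd_mul_iff_left ht0).1 h, hm0⟩, rfl⟩
      · rintro ⟨j, ⟨h, -⟩, rfl⟩
        exact ⟨⟨mul_dvd_mul_left t h, hN⟩, Dvd.intro j rfl⟩
    rw [himg, Finset.sum_map]
    simp only [Function.Embedding.coeFn_mk, Nat.mul_div_mul_left _ _ (Nat.pos_of_ne_zero ht0)]
    rw [sum_divisors_moebius]
    exact if_congr (by rw [eq_comm (a := t), Nat.mul_eq_left ht0]) rfl rfl
  · rw [if_neg (fun h => ht h.dvd), Finset.filter_false_of_mem, Finset.sum_empty]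
    exact fun k hk h => ht (h.trans (Nat.dvd_of_mem_divisors hk))

lemma sum_filter_dvd_not_dvd_moebius {p N t s : ℕ} (hp : p.Prime) (hN : N ≠ 0) (hts : t ∣ s)
    (hst : s ∣ p * t) :
    ∑ k ∈ (N.divisors.filter fun k => ¬ p * k ∣ N) with t ∣ k ∧ ¬ s ∣ k, moebius (N / k) =
      if t = N ∧ s = p * N then 1 else 0 := by
  have empty : (¬ (t = N ∧ s = p * N)) →
      (∀ k, k ∣ N → ¬ p * k ∣ N → t ∣ k → ¬ s ∣ k → False) →
      ∑ k ∈ (N.divisors.filter fun k => ¬ p * k ∣ N) with t ∣ k ∧ ¬ s ∣ k, moebius (N / k) =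
      if t = N ∧ s = p * N then 1 else 0 := fun h1 h2 => by
    rw [if_neg h1, Finset.filter_false_of_mem, Finset.sum_empty]
    intro k hk h
    rw [Finset.mem_filter, Nat.mem_divisors] at hk
    exact h2 k hk.1.1 hk.2 h.1 h.2
  by_cases ht : t ∣ N
  swap
  · exact empty (fun h => ht h.1.dvd) fun k hk _ h _ => ht (h.trans hk)
  have ht0 : t ≠ 0 := by rintro rfl; exact hN (zero_dvd_iff.1 ht)
  obtain ⟨c, rfl⟩ := hts
  have hc : c ∣ p := by
    rw [mul_comm p, mul_dvd_mul_iff_left ht0] at hst; exact hst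
  rcases (Nat.dvd_prime hp).1 hc with rfl | rfl
  · refine empty (fun h => ?_) fun k _ _ h h' => h' (by rwa [mul_one])
    have := h.2.symm.trans ((mul_one t).trans h.1)
    rw [Nat.mul_eq_right hN] at this
    exact hp.ne_one this
  obtain ⟨m, rfl⟩ := ht
  have hm0 := right_ne_zero_of_mul hN
  by_cases hcm : c ∣ m
  · refine empty (fun h => ?_) ?_
    · have : m = 1 := by rw [eq_comm, Nat.mul_eq_left ht0] at h; exact h.1
      exact hp.one_lt.ne' (Nat.dvd_one.1 (this ▸ hcm))
    · rintro k hk h1 ⟨j, rfl⟩ h2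
      rw [mul_dvd_mul_iff_left ht0] at hk h2
      refine h1 ?_
      rw [mul_left_comm, mul_dvd_mul_iff_left ht0]
      exact ((Nat.Prime.coprime_iff_not_dvd hp).2 h2).mul_dvd_of_dvd_of_dvd hcm hk
  · have hfil : {k ∈ (t * m).divisors.filter fun k => ¬ c * k ∣ t * m | t ∣ k ∧ ¬ t * c ∣ k} =
        {k ∈ (t * m).divisors | t ∣ k} := by
      rw [Finset.filter_filter]
      refine Finset.filter_congr fun k hk => ⟨fun h => h.2.1, ?_⟩
      rintro ⟨j, rfl⟩
      have hk := Nat.dvd_of_mem_divisors hk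
      rw [mul_dvd_mul_iff_left ht0] at hk
      rw [mul_left_comm, mul_dvd_mul_iff_left ht0, mul_dvd_mul_iff_left ht0]
      exact ⟨fun h => hcm ((Dvd.intro _ rfl).trans h), Dvd.intro j rfl, fun h => hcm (h.trans hk)⟩
    rw [hfil, sum_filter_dvd_moebius hN]
    refine if_congr ⟨fun h => ⟨h, ?_⟩, fun h => h.1⟩ rfl rfl
    rw [← h, mul_comm]

end Moebius

end Dynatomic

namespace Dynatomic

open MvPolynomial Pair ArithmeticFunction

section FixedPoints

variable {K : Type*} [Field K]

lemma mk_eq_mk_iff_mul_eq_mul {v w : Fin 2 → K} (hv : v ≠ 0) (hw : w ≠ 0) :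
    Projectivization.mk K v hv = Projectivization.mk K w hw ↔ v 0 * w 1 = v 1 * w 0 := by
  have h := linearForm_dvd_linearForm (P := Projectivization.mk K v hv)
    (Q := Projectivization.mk K w hw)
  rw [(associated_linearForm_mk hv).dvd_iff_dvd_right,
    (associated_linearForm_mk hw).dvd_iff_dvd_left,
    vecForm_dvd_iff hw (vecForm_isHomogeneous v), eval_vecForm, sub_eq_zero] at h
  rw [← h, eq_comm]

lemma linearForm_dvd_diff_ofMatrix (Q : ℙ K (Fin 2 → K)) (g g' : GL (Fin 2) K) :
    linearForm Q ∣ diff (ofMatrix g) (ofMatrix g') ↔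
      (Matrix.ProjGenLinGroup.mk g : PGL(2, K)) • Q =
        (Matrix.ProjGenLinGroup.mk g' : PGL(2, K)) • Q := by
  rw [linearForm_eq_vecForm, vecForm_dvd_iff Q.rep_nonzero
    (isHomogeneous_diff (ofMatrix_isHomogeneous g) (ofMatrix_isHomogeneous g'))]
  conv_rhs => rw [← Projectivization.mk_rep Q]
  rw [Projectivization.PGL.mk_smul_mk, Projectivization.PGL.mk_smul_mk, mk_eq_mk_iff_mul_eq_mul]
  simp only [diff, map_sub, map_mul, eval_ofMatrix, sub_eq_zero]
  change _ ↔ g.1.mulVec Q.rep 0 * g'.1.mulVec Q.rep 1 = g.1.mulVec Q.rep 1 * g'.1.mulVec Q.rep 0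
  rw [mul_comm, mul_comm (g.1.mulVec Q.rep 1)]

lemma mem_fixedPoints_iff {Q : ℙ K (Fin 2 → K)} {g : GL (Fin 2) K} :
    Q ∈ fixedPoints g ↔ linearForm Q ∣ diff (ofMatrix g) X := by
  rw [← ofMatrix_one, linearForm_dvd_diff_ofMatrix, map_one, one_smul]; rfl

variable {p : ℕ} {h : GL (Fin 2) K}

lemma mem_fixedPoints_of_dvd_diff_pow (hp : p.Prime)
    (horder : orderOf (Matrix.ProjGenLinGroup.mk h) = p) {Q : ℙ K (Fin 2 → K)} {i j : ℕ}
    (hi : i < p) (hj : j < p) (hij : i ≠ j)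
    (hd : linearForm Q ∣ diff (ofMatrix (h ^ i)) (ofMatrix (h ^ j))) : Q ∈ fixedPoints h := by
  rw [linearForm_dvd_diff_ofMatrix, map_pow, map_pow] at hd
  set x : PGL(2, K) := Matrix.ProjGenLinGroup.mk h
  have h1 : x ^ ((j : ℤ) - i) ∈ MulAction.stabilizer PGL(2, K) Q := by
    rw [MulAction.mem_stabilizer_iff, sub_eq_neg_add, zpow_add, zpow_neg, zpow_natCast,
      zpow_natCast, mul_smul, ← hd, inv_smul_smul]
  have h2 : ¬ (p : ℤ) ∣ (j : ℤ) - i := fun hdvd =>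
    hij (((Nat.modEq_iff_dvd).2 hdvd).eq_of_lt_of_lt hi hj)
  obtain ⟨a, b, hab⟩ := ((Nat.prime_iff_prime_int.1 hp).coprime_iff_not_dvd).2 h2
  have h3 : x = (x ^ ((j : ℤ) - i)) ^ b := by
    have hxp : x ^ (p : ℤ) = 1 := by rw [zpow_natCast, ← horder, pow_orderOf_eq_one]
    calc x = x ^ (a * p + b * ((j : ℤ) - i)) := by rw [hab, zpow_one]
      _ = _ := by rw [zpow_add, mul_comm a, zpow_mul, hxp, one_zpow, one_mul, mul_comm b, zpow_mul]
  have h4 : x ∈ MulAction.stabilizer PGL(2, K) Q := h3 ▸ Subgroup.zpow_mem _ h1 b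
  exact h4

lemma exists_ofMatrix_pow_eq_scale (horder : orderOf (Matrix.ProjGenLinGroup.mk h) = p) :
    ∃ u : Kˣ, h ^ p = Matrix.GeneralLinearGroup.scalar (Fin 2) u := by
  have : Matrix.ProjGenLinGroup.mk (1 : GL (Fin 2) K) = Matrix.ProjGenLinGroup.mk (h ^ p) := by
    rw [map_pow, ← horder, pow_orderOf_eq_one, map_one]
  obtain ⟨u, hu⟩ := Matrix.ProjGenLinGroup.mk_eq_mk_iff.1 this
  exact ⟨u, by rw [← hu, one_mul]⟩

lemma dvd_diff_mul_scalar_iff {m : MvPolynomial (Fin 2) K} {F : Pair K} (g : GL (Fin 2) K)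
    (u : Kˣ) : m ∣ diff F (ofMatrix (g * Matrix.GeneralLinearGroup.scalar (Fin 2) u)) ↔
      m ∣ diff F (ofMatrix g) := by
  rw [ofMatrix_mul, ofMatrix_scalar, comp_scale (ofMatrix_isHomogeneous g), pow_one, comp_X,
    diff_scale_right, (u.isUnit.map C).dvd_mul_left]

lemma exists_lt_dvd_diff_pow (hp : p.Prime)
    (horder : orderOf (Matrix.ProjGenLinGroup.mk h) = p) {m : MvPolynomial (Fin 2) K} {F : Pair K}
    {g : GL (Fin 2) K} (hg : g ∈ Subgroup.zpowers h) (hd : m ∣ diff F (ofMatrix g)) :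
    ∃ j < p, m ∣ diff F (ofMatrix (h ^ j)) := by
  obtain ⟨z, rfl⟩ := hg
  obtain ⟨u, hu⟩ := exists_ofMatrix_pow_eq_scale horder
  have hp0 : (0 : ℤ) < p := by exact_mod_cast hp.pos
  refine ⟨(z % p).toNat, ?_, ?_⟩
  · have := Int.emod_lt_of_pos z hp0; omega
  · have hz : h ^ z = h ^ (z % p).toNat *
        Matrix.GeneralLinearGroup.scalar (Fin 2) (u ^ (z / p)) := by
      rw [map_zpow, ← hu, ← zpow_natCast h, ← zpow_natCast h, ← zpow_mul, ← zpow_add,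
        Int.toNat_of_nonneg (Int.emod_nonneg _ hp0.ne'), Int.emod_add_mul_ediv]
    simp only [hz] at hd
    exact (dvd_diff_mul_scalar_iff _ _).1 hd

lemma pow_dvd_periodPoly_mul {d : ℕ} {φ : Pair K} (hφ : ∀ i, (φ i).IsHomogeneous d)
    (hφ0 : φ.NoCommonZero) (hh : h ∈ commutant hφ) {v : Fin 2 → K} (hv : v ≠ 0) {e k : ℕ}
    (horder : orderOf (Matrix.ProjGenLinGroup.mk h) = p) {g : GL (Fin 2) K}
    (hg : g ∈ Subgroup.zpowers h) (hd : vecForm v ^ e ∣ diff (φ.iter k) (ofMatrix g)) :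
    vecForm v ^ e ∣ periodPoly φ (p * k) := by
  obtain ⟨u, hu⟩ := exists_ofMatrix_pow_eq_scale horder
  have h1 := pow_dvd_diff_iter_mul hφ hφ0 hv ((Subgroup.zpowers_le.2 hh) hg) hd p
  obtain ⟨z, rfl⟩ := hg
  have : (h ^ z) ^ p = 1 * Matrix.GeneralLinearGroup.scalar (Fin 2) (u ^ z) := by
    rw [one_mul, map_zpow, ← hu, ← zpow_natCast, ← zpow_mul, mul_comm, zpow_mul, zpow_natCast]
  simp only [this, dvd_diff_mul_scalar_iff] at h1
  rwa [ofMatrix_one] at h1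

end FixedPoints

lemma pow_dvd_iff_le {R : Type*} [CommRing R] [IsDomain R] [WfDvdMonoid R]
    {l a : R} (hl : Prime l) (ha : a ≠ 0) {e : ℕ} :
    l ^ e ∣ a ↔ e ≤ multiplicity l a :=
  (FiniteMultiplicity.of_not_isUnit hl.not_isUnit ha).pow_dvd_iff_le_multiplicity

lemma sum_ite_le {m E : ℕ} (h : m ≤ E) :
    ∑ e ∈ Finset.Icc 1 E, (if e ≤ m then 1 else 0 : ℤ) = m := by
  rw [Finset.sum_boole]
  have : {e ∈ Finset.Icc 1 E | e ≤ m} = Finset.Icc 1 m := by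
    ext e; simp only [Finset.mem_filter, Finset.mem_Icc]; omega
  rw [this, Nat.card_Icc, Nat.add_sub_cancel]

section LocalOrders

variable {L : Type*} [Field L] {d : ℕ} {φ : Pair L}

lemma diff_iter_ne_zero [IsAlgClosed L] (hφ : ∀ i, (φ i).IsHomogeneous d)
    (hφ0 : φ.NoCommonZero) (hd : 2 ≤ d) {k : ℕ} (hk : k ≠ 0) (g : GL (Fin 2) L) : diff (φ.iter k) (ofMatrix g) ≠ 0 :=
  diff_ofMatrix_ne_zero (hd.trans (Nat.le_self_pow hk d)) (isHomogeneous_iter hφ k) (hφ0.iter k) g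

lemma periodPoly_ne_zero [IsAlgClosed L] (hφ : ∀ i, (φ i).IsHomogeneous d)
    (hφ0 : φ.NoCommonZero) (hd : 2 ≤ d) {k : ℕ} (hk : k ≠ 0) : periodPoly φ k ≠ 0 := by
  have := diff_iter_ne_zero hφ hφ0 hd hk 1
  rwa [ofMatrix_one] at this

lemma psi_ne_zero [IsAlgClosed L] (hφ : ∀ i, (φ i).IsHomogeneous d)
    (hφ0 : φ.NoCommonZero) (hd : 2 ≤ d) {k : ℕ} (hk : k ≠ 0) (h : GL (Fin 2) L) (p : ℕ) : psi φ h p k ≠ 0 :=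
  Finset.prod_ne_zero_iff.2 fun _ _ => diff_iter_ne_zero hφ hφ0 hd hk _

lemma algebraMap_ne_zero {K : Type*} [Field K] {a : MvPolynomial (Fin 2) K} (ha : a ≠ 0) :
    algebraMap _ (RatFun K) a ≠ 0 :=
  (map_ne_zero_iff _ (IsFractionRing.injective _ _)).2 ha

variable (hφ : ∀ i, (φ i).IsHomogeneous d) (hφ0 : φ.NoCommonZero) (hd : 2 ≤ d)
  {Q : ℙ L (Fin 2 → L)} {s t : ℕ → ℕ} (hs : ∀ e k, linearForm Q ^ e ∣ periodPoly φ k ↔ s e ∣ k)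

include hφ hφ0 hd hs in
lemma ordAt_dynatomic [IsAlgClosed L] {M : ℕ} (hM : M ≠ 0) : ordAt Q (dynatomic φ M) =
    ∑ e ∈ Finset.Icc 1 (multiplicity (linearForm Q) (periodPoly φ M)),
      if s e = M then 1 else 0 := by
  have hne : ∀ k ∈ M.divisors, periodPoly φ k ≠ 0 := fun k hk =>
    periodPoly_ne_zero hφ hφ0 hd (Nat.pos_of_mem_divisors hk).ne'
  rw [dynatomic, ordAt_prod Q _ fun k hk => zpow_ne_zero _ (algebraMap_ne_zero (hne k hk))]
  set E := multiplicity (linearForm Q) (periodPoly φ M) with hE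
  have hle : ∀ k ∈ M.divisors, ∀ e, s e ∣ k ↔ e ≤ multiplicity (linearForm Q) (periodPoly φ k) :=
    fun k hk e => by rw [← hs, pow_dvd_iff_le (linearForm_prime Q) (hne k hk)]
  have hb : ∀ k ∈ M.divisors, multiplicity (linearForm Q) (periodPoly φ k) ≤ E := fun k hk =>
    (hle M (Nat.mem_divisors_self M hM) _).1
      (((hle k hk _).2 le_rfl).trans (Nat.dvd_of_mem_divisors hk))
  calc _ = ∑ k ∈ M.divisors, ∑ e ∈ Finset.Icc 1 E,
        if s e ∣ k then moebius (M / k) else 0 := by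
        refine Finset.sum_congr rfl fun k hk => ?_
        rw [ordAt_zpow Q (algebraMap_ne_zero (hne k hk)), ordAt_algebraMap Q (hne k hk),
          ← sum_ite_le (hb k hk), Finset.mul_sum]
        refine Finset.sum_congr rfl fun e _ => ?_
        rw [mul_ite, mul_one, mul_zero]
        exact if_congr (hle k hk e).symm rfl rfl
    _ = _ := by
        rw [Finset.sum_comm]
        refine Finset.sum_congr rfl fun e _ => ?_
        rw [← Finset.sum_filter, sum_filter_dvd_moebius hM]

variable {h : GL (Fin 2) L} (hh : h ∈ commutant hφ) {p : ℕ} (hp : p.Prime)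
  (horder : orderOf (Matrix.ProjGenLinGroup.mk h) = p) (hQ : Q ∉ fixedPoints h)
  (ht : ∀ e k, (∃ g ∈ Subgroup.zpowers h, linearForm Q ^ e ∣ diff (φ.iter k) (ofMatrix g)) ↔
    t e ∣ k)

open scoped Classical in
include hs hp horder hQ ht hφ0 in
lemma sum_ite_dvd_diff {e k : ℕ} (he : e ≠ 0) :
    ∑ j ∈ Finset.Icc 1 (p - 1),
      (if linearForm Q ^ e ∣ diff (φ.iter k) (ofMatrix (h ^ j)) then 1 else 0 : ℤ) =
      if t e ∣ k ∧ ¬ s e ∣ k then 1 else 0 := by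
  have uniq : ∀ i < p, ∀ j < p, linearForm Q ^ e ∣ diff (φ.iter k) (ofMatrix (h ^ i)) →
      linearForm Q ^ e ∣ diff (φ.iter k) (ofMatrix (h ^ j)) → i = j := by
    intro i hi j hj h1 h2
    by_contra hij
    rw [← dvd_neg, ← diff_swap] at h1
    have h3 := pow_dvd_diff_trans (linearForm_prime Q)
      ((hφ0.iter k).exists_not_dvd Q.rep_nonzero) h1 h2
    exact hQ (mem_fixedPoints_of_dvd_diff_pow hp horder hi hj hij ((dvd_pow_self _ he).trans h3))
  have hs0 : s e ∣ k ↔ linearForm Q ^ e ∣ diff (φ.iter k) (ofMatrix (h ^ 0)) := by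
    rw [pow_zero, ofMatrix_one, ← hs]; rfl
  split_ifs with hc
  · obtain ⟨g, hg, hdvd⟩ := (ht e k).2 hc.1
    obtain ⟨j, hj, hjd⟩ := exists_lt_dvd_diff_pow hp horder hg hdvd
    have hj0 : j ≠ 0 := by rintro rfl; exact hc.2 (hs0.2 hjd)
    rw [Finset.sum_eq_single j, if_pos hjd]
    · intro i hi hij
      rw [Finset.mem_Icc] at hi
      exact if_neg fun hid => hij (uniq i (by omega) j hj hid hjd)
    · intro hj'
      exact absurd (Finset.mem_Icc.2 (by omega)) hj'
  · refine Finset.sum_eq_zero fun j hj => if_neg fun hjd => hc ⟨?_, fun hsk => ?_⟩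
    · exact (ht e k).1 ⟨_, Subgroup.npow_mem_zpowers h j, hjd⟩
    · rw [Finset.mem_Icc] at hj
      have := uniq j (by omega) 0 hp.pos hjd (hs0.1 hsk)
      omega

include hs hp horder hQ ht hφ0 hh hd in
lemma ordAt_psiStar [IsAlgClosed L] {N : ℕ} (hN : N ≠ 0) : ordAt Q (psiStar φ h p N) =
    ∑ e ∈ Finset.Icc 1 (multiplicity (linearForm Q) (periodPoly φ (p * N))),
      if t e = N ∧ s e = p * N then 1 else 0 := by
  classical
  have hk0 : ∀ k ∈ N.divisors.filter (fun k => ¬ p * k ∣ N), k ≠ 0 ∧ k ∣ N := fun k hk => by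
    have := (Finset.mem_filter.1 hk).1
    exact ⟨(Nat.pos_of_mem_divisors this).ne', Nat.dvd_of_mem_divisors this⟩
  have hne : ∀ k ∈ N.divisors.filter (fun k => ¬ p * k ∣ N), psi φ h p k ≠ 0 := fun k hk =>
    psi_ne_zero hφ hφ0 hd (hk0 k hk).1 h p
  rw [psiStar, ordAt_prod Q _ fun k hk => zpow_ne_zero _ (algebraMap_ne_zero (hne k hk))]
  set E := multiplicity (linearForm Q) (periodPoly φ (p * N)) with hE
  have hts : ∀ e, t e ∣ s e := fun e => (ht e (s e)).1
    ⟨1, Subgroup.one_mem _, by rw [ofMatrix_one]; exact (hs e (s e)).2 dvd_rfl⟩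
  have hmul : ∀ e k, t e ∣ k → s e ∣ p * k := fun e k hk => by
    obtain ⟨g, hg, hgd⟩ := (ht e k).2 hk
    exact (hs e _).1 (pow_dvd_periodPoly_mul hφ hφ0 hh Q.rep_nonzero horder hg hgd)
  have hb : ∀ k, k ≠ 0 → k ∣ N → ∀ j,
      multiplicity (linearForm Q) (diff (φ.iter k) (ofMatrix (h ^ j))) ≤ E := fun k hk hkN j => by
    rw [hE, ← pow_dvd_iff_le (linearForm_prime Q)
      (periodPoly_ne_zero hφ hφ0 hd (mul_ne_zero hp.ne_zero hN)), hs]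
    refine (hmul _ k ((ht _ k).1 ⟨_, Subgroup.npow_mem_zpowers h j, ?_⟩)).trans
      (mul_dvd_mul_left p hkN)
    rw [pow_dvd_iff_le (linearForm_prime Q) (diff_iter_ne_zero hφ hφ0 hd hk _)]
  have hpsi : ∀ k, k ≠ 0 → k ∣ N → ordAt Q (algebraMap _ (RatFun L) (psi φ h p k)) =
      ∑ e ∈ Finset.Icc 1 E, if t e ∣ k ∧ ¬ s e ∣ k then 1 else 0 := fun k hk hkN => by
    rw [psi, map_prod, ordAt_prod Q _ fun j _ => algebraMap_ne_zero
      (diff_iter_ne_zero hφ hφ0 hd hk (h ^ j))]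
    calc _ = ∑ j ∈ Finset.Icc 1 (p - 1), ∑ e ∈ Finset.Icc 1 E,
          (if linearForm Q ^ e ∣ diff (φ.iter k) (ofMatrix (h ^ j)) then 1 else 0 : ℤ) := by
          refine Finset.sum_congr rfl fun j _ => ?_
          have hne := diff_iter_ne_zero hφ hφ0 hd hk (h ^ j)
          rw [ordAt_algebraMap Q hne, ← sum_ite_le (hb k hk hkN j)]
          exact Finset.sum_congr rfl fun e _ =>
            if_congr (pow_dvd_iff_le (linearForm_prime Q) hne).symm rfl rfl
      _ = _ := by
          rw [Finset.sum_comm]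
          refine Finset.sum_congr rfl fun e he => ?_
          exact sum_ite_dvd_diff hφ0 hs hp horder hQ ht
            (Nat.pos_iff_ne_zero.1 (Finset.mem_Icc.1 he).1)
  calc _ = ∑ k ∈ N.divisors.filter (fun k => ¬ p * k ∣ N), ∑ e ∈ Finset.Icc 1 E,
        if t e ∣ k ∧ ¬ s e ∣ k then moebius (N / k) else 0 := by
        refine Finset.sum_congr rfl fun k hk => ?_
        rw [ordAt_zpow Q (algebraMap_ne_zero (hne k hk)), hpsi k (hk0 k hk).1 (hk0 k hk).2,
          Finset.mul_sum]
        exact Finset.sum_congr rfl fun e _ => by rw [mul_ite, mul_one, mul_zero]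
    _ = _ := by
        rw [Finset.sum_comm]
        refine Finset.sum_congr rfl fun e _ => ?_
        rw [← Finset.sum_filter,
          sum_filter_dvd_not_dvd_moebius hp hN (hts e) (hmul e _ dvd_rfl)]

include hφ hφ0 in
lemma exists_pow_dvd_periodPoly_iff (Q : ℙ L (Fin 2 → L)) :
    ∃ s : ℕ → ℕ, ∀ e k, linearForm Q ^ e ∣ periodPoly φ k ↔ s e ∣ k := by
  choose s hs using fun e => exists_agreement_iff_dvd hφ hφ0 Q.rep_nonzero e
    (bot_le : ⊥ ≤ commutant hφ)
  refine ⟨s, fun e k => ?_⟩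
  rw [← hs]
  simp only [Subgroup.mem_bot, exists_eq_left, ofMatrix_one]
  rfl

include hφ hφ0 hd in
lemma ordAt_dynatomic_nonneg [IsAlgClosed L] {M : ℕ} (hM : M ≠ 0) (Q : ℙ L (Fin 2 → L)) :
    0 ≤ ordAt Q (dynatomic φ M) := by
  obtain ⟨s, hs⟩ := exists_pow_dvd_periodPoly_iff hφ hφ0 Q
  rw [ordAt_dynatomic hφ hφ0 hd hs hM]
  exact Finset.sum_nonneg fun e _ => by split_ifs <;> norm_num

include hφ0 hd hh hp horder hQ in
lemma ordAt_psiStar_nonneg_and_le [IsAlgClosed L] {N : ℕ} (hN : N ≠ 0) :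
    0 ≤ ordAt Q (psiStar φ h p N) ∧
      ordAt Q (psiStar φ h p N) ≤ ordAt Q (dynatomic φ (p * N)) := by
  obtain ⟨s, hs⟩ := exists_pow_dvd_periodPoly_iff hφ hφ0 Q
  choose t ht using fun e => exists_agreement_iff_dvd hφ hφ0 Q.rep_nonzero e
    (Subgroup.zpowers_le.2 hh)
  rw [ordAt_dynatomic hφ hφ0 hd hs (mul_ne_zero hp.ne_zero hN),
    ordAt_psiStar hφ hφ0 hd hs hh hp horder hQ ht hN]
  refine ⟨Finset.sum_nonneg fun e _ => by split_ifs <;> norm_num,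
    Finset.sum_le_sum fun e _ => ?_⟩
  split_ifs with h1 h2
  exacts [le_rfl, absurd h1.2 h2, zero_le_one, le_rfl]

end LocalOrders

end Dynatomic

namespace Dynatomic

open MvPolynomial Pair

section BaseChange

variable {K L : Type*} [Field K] [Field L] (σ : K →+* L)

lemma map_comp (F G : Pair K) : (F.comp G).map σ = (F.map σ).comp (G.map σ) :=
  funext fun i => map_bind₁ σ G (F i)

lemma map_iter (φ : Pair K) (k : ℕ) : (φ.iter k).map σ = (φ.map σ).iter k := by
  induction k with
  | zero => exact funext fun i => map_X σ i
  | succ k ih => rw [Pair.iter, map_comp, ih]; rfl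

lemma map_ofMatrix (g : GL (Fin 2) K) :
    (ofMatrix g).map σ = ofMatrix (Matrix.GeneralLinearGroup.map σ g) := by
  ext1 i
  simp [Pair.map, ofMatrix]

lemma map_diff (F G : Pair K) : MvPolynomial.map σ (diff F G) = diff (F.map σ) (G.map σ) := by
  simp [diff, Pair.map]

lemma map_X_pair : Pair.map σ (X : Pair K) = X := funext fun i => map_X σ i

lemma map_periodPoly (φ : Pair K) (k : ℕ) :
    MvPolynomial.map σ (periodPoly φ k) = periodPoly (φ.map σ) k := by
  have := map_diff σ (φ.iter k) X
  rwa [map_iter, map_X_pair] at this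

lemma map_psi (φ : Pair K) (h : GL (Fin 2) K) (p k : ℕ) : MvPolynomial.map σ (psi φ h p k) =
    psi (φ.map σ) (Matrix.GeneralLinearGroup.map σ h) p k := by
  simp_rw [psi, map_prod, map_diff, map_iter, map_ofMatrix, map_pow]

lemma ratMap_dynatomic (φ : Pair K) (N : ℕ) :
    ratMap σ (dynatomic φ N) = dynatomic (φ.map σ) N := by
  simp_rw [dynatomic, map_prod, map_zpow₀, ratMap_algebraMap, map_periodPoly]

lemma ratMap_psiStar (φ : Pair K) (h : GL (Fin 2) K) (p N : ℕ) : ratMap σ (psiStar φ h p N) =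
    psiStar (φ.map σ) (Matrix.GeneralLinearGroup.map σ h) p N := by
  simp_rw [psiStar, map_prod, map_zpow₀, ratMap_algebraMap, map_psi]

lemma HasAut.map {φ : Pair K} {h : GL (Fin 2) K} (hh : φ.HasAut h) :
    (φ.map σ).HasAut (Matrix.GeneralLinearGroup.map σ h) := by
  obtain ⟨u, hu, hh⟩ := hh
  refine ⟨σ u, (map_ne_zero σ).2 hu, ?_⟩
  have := congrArg (Pair.map σ) hh
  rw [map_comp, map_comp, map_ofMatrix, map_ofMatrix, map_inv] at this
  rw [this]
  ext1 i
  simp [Pair.map]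

lemma pointMap_mk {v : Fin 2 → K} (hv : v ≠ 0) (hv' : σ ∘ v ≠ 0) :
    pointMap σ (Projectivization.mk K v hv) = Projectivization.mk L (σ ∘ v) hv' := by
  obtain ⟨a, ha⟩ := Projectivization.exists_smul_eq_mk_rep K v hv
  rw [pointMap, Projectivization.mk_eq_mk_iff']
  refine ⟨σ a, ?_⟩
  ext i
  simp [← ha, Units.smul_def]

lemma pointMap_injective : Function.Injective (pointMap σ) := fun P P' h => by
  have h1 := linearForm_dvd_linearForm.2 h
  rwa [(associated_linearForm_pointMap σ P).dvd_iff_dvd_right,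
    (associated_linearForm_pointMap σ P').dvd_iff_dvd_left, map_dvd_map_iff,
    linearForm_dvd_linearForm] at h1

lemma pointMap_mem_fixedPoints_iff {P : ℙ K (Fin 2 → K)} {g : GL (Fin 2) K} :
    pointMap σ P ∈ fixedPoints (Matrix.GeneralLinearGroup.map σ g) ↔ P ∈ fixedPoints g := by
  rw [mem_fixedPoints_iff, mem_fixedPoints_iff, ← map_ofMatrix, ← map_X_pair σ, ← map_diff,
    (associated_linearForm_pointMap σ P).dvd_iff_dvd_left, map_dvd_map_iff]

lemma mk_eq_one_iff {g : GL (Fin 2) K} :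
    Matrix.ProjGenLinGroup.mk g = 1 ↔ diff (ofMatrix g) X = 0 := by
  constructor
  · intro h
    obtain ⟨u, hu⟩ := Matrix.ProjGenLinGroup.mk_eq_mk_iff.1 ((map_one _).trans h.symm)
    rw [← hu, one_mul, ofMatrix_scalar, diff_scale_left, diff, mul_comm (X 1), sub_self,
      mul_zero]
  · intro h
    have key : ∀ v : Fin 2 → K, v 1 * g.1.mulVec v 0 - v 0 * g.1.mulVec v 1 = 0 := fun v => by
      simpa [diff, eval_ofMatrix] using congrArg (eval v) h
    have h10 : g.1 1 0 = 0 := by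
      simpa [Matrix.mulVec, dotProduct, Fin.sum_univ_two] using key ![1, 0]
    have h01 : g.1 0 1 = 0 := by
      simpa [Matrix.mulVec, dotProduct, Fin.sum_univ_two] using key ![0, 1]
    have h11 : g.1 0 0 = g.1 1 1 := by
      simpa [Matrix.mulVec, dotProduct, Fin.sum_univ_two, h10, h01, sub_eq_zero] using key ![1, 1]
    have hdet : g.1.det ≠ 0 := ((Matrix.isUnit_iff_isUnit_det _).1 g.isUnit).ne_zero
    have h00 : g.1 0 0 ≠ 0 := fun h0 => hdet (by rw [Matrix.det_fin_two, h0, h10]; ring)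
    rw [← map_one Matrix.ProjGenLinGroup.mk, eq_comm, Matrix.ProjGenLinGroup.mk_eq_mk_iff]
    refine ⟨Units.mk0 _ h00, ?_⟩
    rw [one_mul]
    ext i j
    fin_cases i <;> fin_cases j <;> simp [h10, h01, h11]

lemma orderOf_mk_map {g : GL (Fin 2) K} {p : ℕ} (hp : p.Prime)
    (h : orderOf (Matrix.ProjGenLinGroup.mk g) = p) :
    orderOf (Matrix.ProjGenLinGroup.mk (Matrix.GeneralLinearGroup.map σ g)) = p := by
  have key : ∀ f : GL (Fin 2) K,
      Matrix.ProjGenLinGroup.mk (Matrix.GeneralLinearGroup.map σ f) = 1 ↔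
        Matrix.ProjGenLinGroup.mk f = 1 := fun f => by
    rw [mk_eq_one_iff, mk_eq_one_iff, ← map_ofMatrix, ← map_X_pair σ, ← map_diff,
      map_eq_zero_iff _ (map_injective σ σ.injective)]
  have := Fact.mk hp
  refine orderOf_eq_prime ?_ fun h1 => ?_
  · rw [← map_pow, ← map_pow, key, map_pow, ← h, pow_orderOf_eq_one]
  · rw [key, ← orderOf_eq_one_iff, h] at h1
    exact hp.ne_one h1

lemma finite_linearForm_dvd {D : MvPolynomial (Fin 2) K} (hD : D ≠ 0) :
    {P : ℙ K (Fin 2 → K) | linearForm P ∣ D}.Finite := by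
  classical
  let _ := UniqueFactorizationMonoid.fintypeSubtypeDvd (Associates.mk D)
    (Associates.mk_ne_zero.2 hD)
  refine Finite.of_injective (β := {a // a ∣ Associates.mk D})
    (fun P => ⟨Associates.mk (linearForm P.1), Associates.mk_dvd_mk.2 P.2⟩) fun P P' h => ?_
  have h1 := Associates.mk_eq_mk_iff_associated.1 (congrArg Subtype.val h)
  exact Subtype.ext (linearForm_dvd_linearForm.1 h1.dvd')

lemma finite_fixedPoints {h : GL (Fin 2) K} (hh : Matrix.ProjGenLinGroup.mk h ≠ 1) :
    (fixedPoints h).Finite :=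
  (finite_linearForm_dvd (mt mk_eq_one_iff.2 hh)).subset fun _ => mem_fixedPoints_iff.1

lemma tuned_eq {φ : Pair K} {h : GL (Fin 2) K} (hfin : (fixedPoints h).Finite) (p N : ℕ) :
    tuned φ h p N = psiStar φ h p N / ∏ P ∈ hfin.toFinset,
      algebraMap _ (RatFun K) (linearForm P) ^ ordAt P (psiStar φ h p N) := by
  rw [tuned, finprod_mem_eq_finite_toFinset_prod _ hfin]

open scoped Classical in
lemma ordAt_ratMap_tuned {φ : Pair K} {h : GL (Fin 2) K} (hfin : (fixedPoints h).Finite)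
    {p N : ℕ} (hψ : psiStar φ h p N ≠ 0) {S : Set (ℙ L (Fin 2 → L))}
    (hS : ∀ Q, Q ∈ S ↔ ∃ P ∈ fixedPoints h, pointMap σ P = Q) (Q : ℙ L (Fin 2 → L)) :
    ordAt Q (ratMap σ (tuned φ h p N)) =
      if Q ∈ S then 0 else ordAt Q (ratMap σ (psiStar φ h p N)) := by
  have hl : ∀ P : ℙ K (Fin 2 → K), ratMap σ (algebraMap _ (RatFun K) (linearForm P)) ≠ 0 :=
    fun P => (map_ne_zero _).2 (algebraMap_ne_zero (linearForm_prime P).ne_zero)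
  rw [tuned_eq hfin, map_div₀, map_prod, ordAt_div' Q ((map_ne_zero _).2 hψ)
    (Finset.prod_ne_zero_iff.2 fun P _ => by rw [map_zpow₀]; exact zpow_ne_zero _ (hl P)),
    ordAt_prod Q _ fun P _ => by rw [map_zpow₀]; exact zpow_ne_zero _ (hl P)]
  simp_rw [map_zpow₀, ordAt_zpow Q (hl _), ordAt_ratMap_linearForm]
  split_ifs with hQ
  · obtain ⟨P, hP, rfl⟩ := (hS Q).1 hQ
    simp only [(pointMap_injective σ).eq_iff, mul_ite, mul_one, mul_zero]
    rw [Finset.sum_ite_eq', if_pos (hfin.mem_toFinset.2 hP), ordAt_pointMap σ P hψ, sub_self]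
  · rw [Finset.sum_eq_zero, sub_zero]
    intro P hP
    rw [if_neg fun hPQ => hQ ((hS Q).2 ⟨P, hfin.mem_toFinset.1 hP, hPQ⟩), mul_zero]

lemma ratMap_id (f : RatFun K) : ratMap (RingHom.id K) f = f := by
  obtain ⟨a, b, -, rfl⟩ := IsFractionRing.div_surjective (A := MvPolynomial (Fin 2) K) f
  rw [map_div₀, ratMap_algebraMap, ratMap_algebraMap, map_id, map_id]

lemma pointMap_id (P : ℙ K (Fin 2 → K)) : pointMap (RingHom.id K) P = P := P.mk_rep

open scoped Classical in
lemma ordAt_tuned {φ : Pair K} {h : GL (Fin 2) K} (hfin : (fixedPoints h).Finite)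
    {p N : ℕ} (hψ : psiStar φ h p N ≠ 0) (Q : ℙ K (Fin 2 → K)) :
    ordAt Q (tuned φ h p N) = if Q ∈ fixedPoints h then 0 else ordAt Q (psiStar φ h p N) := by
  have := ordAt_ratMap_tuned (RingHom.id K) hfin hψ (S := fixedPoints h)
    (fun Q => by simp [pointMap_id]) Q
  rwa [ratMap_id, ratMap_id] at this

lemma isHomogeneousFraction_dynatomic {d : ℕ} {φ : Pair K} (hφ : ∀ i, (φ i).IsHomogeneous d)
    (h0 : ∀ k, k ≠ 0 → periodPoly φ k ≠ 0) (N : ℕ) : IsHomogeneousFraction (dynatomic φ N) :=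
  .prod _ fun k hk => .zpow (.of_isHomogeneous
    (isHomogeneous_diff (isHomogeneous_iter hφ k) (isHomogeneous_X K))
    (h0 k (Nat.pos_of_mem_divisors hk).ne')) _

lemma isHomogeneousFraction_psiStar {d : ℕ} {φ : Pair K} (hφ : ∀ i, (φ i).IsHomogeneous d)
    {h : GL (Fin 2) K} {p : ℕ} (h0 : ∀ k, k ≠ 0 → psi φ h p k ≠ 0) (N : ℕ) :
    IsHomogeneousFraction (psiStar φ h p N) :=
  .prod _ fun k hk => .zpow (.of_isHomogeneous (IsHomogeneous.prod _ _ _ fun j _ =>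
    isHomogeneous_diff (isHomogeneous_iter hφ k) (ofMatrix_isHomogeneous (h ^ j)))
    (h0 k (Nat.pos_of_mem_divisors (Finset.mem_filter.1 hk).1).ne')) _

lemma IsHomogeneousFraction.tuned {φ : Pair K} {h : GL (Fin 2) K}
    (hfin : (fixedPoints h).Finite) {p N : ℕ} (hψ : IsHomogeneousFraction (psiStar φ h p N)) :
    IsHomogeneousFraction (tuned φ h p N) := by
  rw [tuned_eq hfin]
  exact hψ.div (.prod _ fun P _ => .zpow (.of_isHomogeneous (vecForm_isHomogeneous P.rep)
    (linearForm_prime P).ne_zero) _)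

lemma noCommonZero_of_isRelPrime {d : ℕ} {φ : Pair K} (hφ : ∀ i, (φ i).IsHomogeneous d)
    (h : IsRelPrime (φ 0) (φ 1)) : φ.NoCommonZero := fun v hv => by
  by_contra! H
  exact (vecForm_prime hv).not_isUnit
    (h (vecForm_dvd_of_eval_eq_zero hv (hφ 0) (H 0)) (vecForm_dvd_of_eval_eq_zero hv (hφ 1) (H 1)))

end BaseChange

end Dynatomic

open Dynatomic Dynatomic.Pair in
theorem mainTheorem6 {K : Type*} [Field K] (φ : Dynatomic.Pair K) (d : ℕ) (hd : 2 ≤ d)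
    (hφ : φ.IsRationalMap d) (p : ℕ) (hp : p.Prime) (h : GL (Fin 2) K)
    (horder : orderOf (Matrix.ProjGenLinGroup.mk h) = p) (haut : φ.HasAut h)
    (hfix : ∀ P ∈ Dynatomic.geomFixedPoints h, Dynatomic.IsDefinedOver K P)
    (N : ℕ) (hN : 1 ≤ N) :
    (∃ A B : MvPolynomial (Fin 2) K,
      algebraMap (MvPolynomial (Fin 2) K) (Dynatomic.RatFun K) A = Dynatomic.dynatomic φ (p * N) ∧
      algebraMap (MvPolynomial (Fin 2) K) (Dynatomic.RatFun K) B = Dynatomic.tuned φ h p N ∧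
      B ∣ A) ∧
    ∀ Q : ℙ (AlgebraicClosure K) (Fin 2 → AlgebraicClosure K),
      Dynatomic.bTildeStar φ h p N Q ≤ Dynatomic.aStar φ (p * N) Q := by
  classical
  set σ := algebraMap K (AlgebraicClosure K) with hσ
  have hN0 : N ≠ 0 := by omega
  have hpN : p * N ≠ 0 := mul_ne_zero hp.ne_zero hN0
  have hom := hφ.homogeneous
  have hom' : ∀ i, (φ.map σ i).IsHomogeneous d := fun i => (hom i).map σ
  have hncz : (φ.map σ).NoCommonZero := noCommonZero_of_isRelPrime hom' hφ.coprime
  have horder' := orderOf_mk_map σ hp horder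
  have hcomm := HasAut.mem_commutant hom' (HasAut.map σ haut)
  have mk_ne_one : ∀ {F : Type _} [Field F] {g : GL (Fin 2) F},
      orderOf (Matrix.ProjGenLinGroup.mk g) = p → Matrix.ProjGenLinGroup.mk g ≠ 1 := by
    intro F _ g hg h1
    rw [h1, orderOf_one] at hg
    exact hp.ne_one hg.symm
  have hfin := finite_fixedPoints (mk_ne_one horder)
  have hfin' := finite_fixedPoints (mk_ne_one horder')
  have hdyn : IsHomogeneousFraction (dynatomic φ (p * N)) :=
    isHomogeneousFraction_dynatomic hom (fun k hk h0 => periodPoly_ne_zero hom' hncz hd hk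
      (by rw [← map_periodPoly, h0, map_zero])) _
  have hpsi : IsHomogeneousFraction (psiStar φ h p N) :=
    isHomogeneousFraction_psiStar hom (fun k hk h0 => psi_ne_zero hom' hncz hd hk _ p
      (by rw [← map_psi, h0, map_zero])) _
  have hpsi' : psiStar (φ.map σ) (Matrix.GeneralLinearGroup.map σ h) p N ≠ 0 := by
    rw [← ratMap_psiStar]; exact (map_ne_zero _).2 hpsi.ne_zero
  have htuned := hpsi.tuned hfin
  have hS : ∀ Q, Q ∈ geomFixedPoints h ↔ ∃ P ∈ fixedPoints h, pointMap σ P = Q := by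
    refine fun Q => ⟨fun hQ => ?_, ?_⟩
    · obtain ⟨v, hv, rfl⟩ := hfix Q hQ
      have hv0 : v ≠ 0 := by
        rintro rfl; exact hv (funext fun i => map_zero _)
      have hP := pointMap_mk σ hv0 hv
      exact ⟨_, (pointMap_mem_fixedPoints_iff σ).1 (hP ▸ hQ), hP⟩
    · rintro ⟨P, hP, rfl⟩
      exact (pointMap_mem_fixedPoints_iff σ).2 hP
  have hb : ∀ Q, ordAt Q (ratMap σ (tuned φ h p N)) = bTildeStar φ h p N Q := fun Q => by
    rw [ordAt_ratMap_tuned σ hfin hpsi.ne_zero hS, ratMap_psiStar, bTildeStar,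
      ordAt_tuned hfin' hpsi']
    rfl
  have ha : ∀ Q, ordAt Q (ratMap σ (dynatomic φ (p * N))) = aStar φ (p * N) Q := fun Q => by
    rw [ratMap_dynatomic]; rfl
  have ha0 : ∀ Q, 0 ≤ aStar φ (p * N) Q := ordAt_dynatomic_nonneg hom' hncz hd hpN
  have hab : ∀ Q, 0 ≤ bTildeStar φ h p N Q ∧ bTildeStar φ h p N Q ≤ aStar φ (p * N) Q := by
    intro Q
    rw [bTildeStar, ordAt_tuned hfin' hpsi']
    split_ifs with hQ
    · exact ⟨le_rfl, ha0 Q⟩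
    · exact ordAt_psiStar_nonneg_and_le hom' hncz hd hcomm hp horder' hQ hN0
  refine ⟨?_, fun Q => (hab Q).2⟩
  obtain ⟨A, hA⟩ := hdyn.exists_algebraMap_eq σ fun Q => (ha Q).symm ▸ ha0 Q
  obtain ⟨B, hB⟩ := htuned.exists_algebraMap_eq σ fun Q => (hb Q).symm ▸ (hab Q).1
  obtain ⟨D, hD⟩ := (hdyn.div htuned).exists_algebraMap_eq σ fun Q => by
    rw [map_div₀, ordAt_div' Q ((map_ne_zero _).2 hdyn.ne_zero)
      ((map_ne_zero _).2 htuned.ne_zero), ha, hb]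
    exact sub_nonneg.2 (hab Q).2
  refine ⟨A, B, hA, hB, D, IsFractionRing.injective (MvPolynomial (Fin 2) K) (RatFun K) ?_⟩
  rw [map_mul, hA, hB, hD, mul_div_cancel₀ _ htuned.ne_zero]
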